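/- Let $\mathbb K$ be a field of characteristic zero. Let $\mathfrak a$ be the Lie algebra over $\mathbb K$ generated by $H, X^-, X^+$ subject to the relations $[H,X^{\pm}] = \pm 2X^{\pm}$, and let $\mathfrak{sl}_2$ be the Lie algebra of traceless $2\times 2$ matrices, with its Chevalley generators $H, X^-, X^+$ (so that moreover $[X^+,X^-]=H$). The projection $\mathfrak a \to \mathfrak{sl}_2$ makes $U(\mathfrak{sl}_2)$ a $U(\mathfrak a)$-algebra ($\mathfrak a$-algebra for short). Put $U_h(\mathfrak a) = U(\mathfrak a)[[h]]$; a $U_h(\mathfrak a)$-algebra is a unital associative $\mathbb K[[h]]$-algebra $A$ with a structural $\mathbb K[[h]]$-algebra homomorphism $f : U_h(\mathfrak a)\to A$, and isomorphisms of $U_h(\mathfrak a)$-algebras are the $\mathbb K[[h]]$-algebra isomorphisms compatible with the structural homomorphisms. For such an $A$, the $\mathbb K$-algebra $A/hA$ is an $\mathfrak a$-algebra through $U(\mathfrak a)\subset U_h(\mathfrak a)\to A \to A/hA$. A formal deformation of the $\mathfrak a$-algebra $U(\mathfrak{sl}_2)$ is a $U_h(\mathfrak a)$-algebra $A$ which is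 topologically free as a $\mathbb K[[h]]$-module (isomorphic to $V_0[[h]]$ for some $\mathbb K$-vector space $V_0$) and such that $A/hA$ and $U(\mathfrak{sl}_2)$ are isomorphic as $\mathfrak a$-algebras. It is $\mathfrak h$-trivial if there is a $\mathbb K[[h]]$-algebra isomorphism $g : U(\mathfrak{sl}_2)[[h]] \to A$ such that $g(H)$ is the image of $H$ in $A$, and such that the map induced by $g$ modulo $h$ is an isomorphism of $\mathfrak a$-algebras. A colouring is a family $\psi = (\psi^k(n))_{k\ge 1,\, n\in\mathbb Z}$ of elements of $\mathbb K[[h]]$ such that $\psi^k(n) \equiv k(n-k+1) \bmod h$ for all $k,n$; $\psi^{n+1}(n)=0$ for all $n\ge 0$; and $\psi^{n+k+1}(n)=\psi^k(-n-2)$ for all $k\geq 1$ and $n\ge 0$. It is regular if for every $m \geq 0$ the coefficient of $h^m$ in $\psi^k(n)$ is given by a polynomial in $k$ and $n$ with coefficients in $\mathbb K$. For $n\in\mathbb Z$, let $V(n,\psi)$ be the $\mathbb K[[h]]$-module $\bigl(\bigoplus_{k\ge 0}\mathbb K b_k\bigr)[[h]]$ on which $U_h(\mathfrak a)$ acts by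 $H b_k=(n-2k)b_k$, $X^-b_k=b_{k+1}$, $X^+b_0=0$ and $X^+b_k=\psi^k(n)b_{k-1}$ for $k\ge 1$. Let $I_h(\psi)$ be the two-sided ideal of the elements of $U_h(\mathfrak a)$ which act by zero on $V(n,\psi)$ for all $n\in\mathbb Z$, and let $U_h(\psi)=U_h(\mathfrak a)/I_h(\psi)$. Theorem. (1) For every $\mathfrak h$-trivial formal deformation $A$ of the $\mathfrak a$-algebra $U(\mathfrak{sl}_2)$, there is a unique regular colouring $\psi$ such that $A$ and $U_h(\psi)$ are isomorphic as $U_h(\mathfrak a)$-algebras. (2) For every regular colouring $\psi$, the $U_h(\mathfrak a)$-algebra $U_h(\psi)$ is an $\mathfrak h$-trivial formal deformation of the $\mathfrak a$-algebra $U(\mathfrak{sl}_2)$. Hence $\psi\mapsto U_h(\psi)$ induces a bijection between regular colourings and isomorphism classes of $\mathfrak h$-trivial formal deformations of the $\mathfrak a$-algebra $U(\mathfrak{sl}_2)$. -/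

import Mathlib

open scoped PowerSeries
open Finset.HasAntidiagonal (antidiagonal)

noncomputable section

namespace ColouredKM

universe u v

attribute [local instance 100] LieRing.ofAssociativeRing

/-! ## Power series with coefficients in a module or in an algebra

The formal parameter `h` is `PowerSeries.X`. -/

section FormalSeries

/-- For a vector space `V`, the set `V⟦h⟧` of series `∑ vₘ hᵐ` with `vₘ ∈ V`,
given by the sequence of their coefficients. -/
def FormalSeries (V : Type*) : Type _ := ℕ → V

instance (V : Type*) [AddCommGroup V] : AddCommGroup (FormalSeries V) :=
  inferInstanceAs (AddCommGroup (ℕ → V))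

/-- `V⟦h⟧` is a module over `R⟦h⟧` as soon as `V` is a module over the
(not necessarily commutative) ring `R`, with the Cauchy product as action. -/
instance (R V : Type*) [Semiring R] [AddCommGroup V] [Module R V] :
    Module R⟦X⟧ (FormalSeries V) where
  smul f v := fun m => ∑ p ∈ antidiagonal m, PowerSeries.coeff p.1 f • v p.2
  one_smul v := by
    funext m
    change ∑ p ∈ antidiagonal m, PowerSeries.coeff p.1 (1 : R⟦X⟧) • v p.2 = v m
    rw [Finset.sum_eq_single (0, m)]
    · simp
    · rintro ⟨i, j⟩ hp hne
      have hi : i ≠ 0 := by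
        rintro rfl
        apply hne
        simpa using hp
      simp [PowerSeries.coeff_one, hi]
    · intro hn
      simp at hn
  mul_smul f g v := by
    funext m
    change ∑ p ∈ antidiagonal m, PowerSeries.coeff p.1 (f * g) • v p.2
      = ∑ p ∈ antidiagonal m, PowerSeries.coeff p.1 f •
          ∑ q ∈ antidiagonal p.2, PowerSeries.coeff q.1 g • v q.2
    simp only [PowerSeries.coeff_mul, Finset.sum_smul, Finset.smul_sum, mul_smul]
    rw [Finset.sum_sigma', Finset.sum_sigma']
    refine Finset.sum_nbij' (fun s => ⟨(s.2.1, s.2.2 + s.1.2), (s.2.2, s.1.2)⟩)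
      (fun s => ⟨(s.1.1 + s.2.1, s.2.2), (s.1.1, s.2.1)⟩) ?_ ?_ ?_ ?_ ?_ <;>
    · rintro ⟨⟨a, b⟩, ⟨c, d⟩⟩
      simp only [Finset.mem_sigma, Finset.HasAntidiagonal.mem_antidiagonal]
      rintro ⟨h1, h2⟩
      subst h2
      subst h1
      simp [add_assoc]
  smul_zero f := by
    funext m
    change ∑ p ∈ antidiagonal m, PowerSeries.coeff p.1 f • (0 : V) = 0
    simp
  smul_add f v w := by
    funext m
    change ∑ p ∈ antidiagonal m, PowerSeries.coeff p.1 f • (v p.2 + w p.2)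
      = ∑ p ∈ antidiagonal m, PowerSeries.coeff p.1 f • v p.2
        + ∑ p ∈ antidiagonal m, PowerSeries.coeff p.1 f • w p.2
    simp [smul_add, Finset.sum_add_distrib]
  add_smul f g v := by
    funext m
    change ∑ p ∈ antidiagonal m, PowerSeries.coeff p.1 (f + g) • v p.2
      = ∑ p ∈ antidiagonal m, PowerSeries.coeff p.1 f • v p.2
        + ∑ p ∈ antidiagonal m, PowerSeries.coeff p.1 g • v p.2
    simp [add_smul, Finset.sum_add_distrib]
  zero_smul v := by
    funext m
    change ∑ p ∈ antidiagonal m, PowerSeries.coeff p.1 (0 : R⟦X⟧) • v p.2 = 0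
    simp

theorem FormalSeries.smul_apply {R V : Type*} [Semiring R] [AddCommGroup V] [Module R V]
    (f : R⟦X⟧) (v : FormalSeries V) (m : ℕ) :
    (f • v) m = ∑ p ∈ antidiagonal m, PowerSeries.coeff p.1 f • v p.2 := rfl

/-- For a `k`-algebra `B`, the ring `B⟦h⟧` is a `k⟦h⟧`-algebra. -/
instance (priority := 50) seriesAlgebra (k B : Type*) [Field k] [Semiring B] [Algebra k B] :
    Algebra k⟦X⟧ B⟦X⟧ :=
  (PowerSeries.map (algebraMap k B)).toAlgebra' fun c x => by
    ext m
    rw [PowerSeries.coeff_mul, PowerSeries.coeff_mul, ← Finset.Nat.sum_antidiagonal_swap]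
    refine Finset.sum_congr rfl fun p _ => ?_
    simp [Algebra.commutes]

/-- A `k⟦h⟧`-module is topologically free if it is isomorphic to `V₀⟦h⟧`
for some `k`-vector space `V₀`. -/
def IsTopologicallyFree (k : Type u) [Field k] (A : Type v) [AddCommGroup A] [Module k⟦X⟧ A] :
    Prop :=
  ∃ (V₀ : Type v) (_ : AddCommGroup V₀) (_ : Module k V₀),
    Nonempty (A ≃ₗ[k⟦X⟧] FormalSeries V₀)

/-- A `k`-algebra homomorphism `B → B'` induces a `k⟦h⟧`-algebra homomorphism `B⟦h⟧ → B'⟦h⟧`. -/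
def mapSeries {k B B' : Type*} [Field k] [Semiring B] [Algebra k B] [Semiring B'] [Algebra k B']
    (f : B →ₐ[k] B') : B⟦X⟧ →ₐ[k⟦X⟧] B'⟦X⟧ where
  __ := PowerSeries.map (f : B →+* B')
  commutes' c := by
    ext m
    change PowerSeries.coeff m (PowerSeries.map (f : B →+* B')
      (PowerSeries.map (algebraMap k B) c)) = PowerSeries.coeff m
      (PowerSeries.map (algebraMap k B') c)
    simp

/-- The `h`-adically continuous extension `B⟦h⟧ → S⟦h⟧`, `∑ xᵢ hⁱ ↦ ∑ ρ(xᵢ) hⁱ`, of a `k`-algebra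
homomorphism `ρ : B → S⟦h⟧`. -/
def extendSeries {k B S : Type*} [Field k] [Semiring B] [Algebra k B] [Semiring S] [Algebra k S]
    (ρ : B →ₐ[k] S⟦X⟧) : B⟦X⟧ →ₐ[k⟦X⟧] S⟦X⟧ where
  toFun x := PowerSeries.mk fun m =>
    ∑ p ∈ antidiagonal m, PowerSeries.coeff p.2 (ρ (PowerSeries.coeff p.1 x))
  map_one' := by
    ext m
    rw [PowerSeries.coeff_mk, Finset.sum_eq_single (0, m)]
    · simp
    · rintro ⟨i, j⟩ hp hne
      have hi : i ≠ 0 := by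
        rintro rfl
        apply hne
        simpa using hp
      simp [PowerSeries.coeff_one, hi]
    · intro hn
      simp at hn
  map_mul' x y := by
    ext m
    simp only [PowerSeries.coeff_mk, PowerSeries.coeff_mul, map_sum, map_mul,
      Finset.sum_mul_sum]
    simp only [Finset.sum_sigma']
    refine Finset.sum_nbij'
      (fun s => ⟨(s.2.1.1 + s.2.2.1, s.2.1.2 + s.2.2.2), ⟨(s.2.1.1, s.2.2.1), (s.2.1.2, s.2.2.2)⟩⟩)
      (fun s => ⟨(s.2.1.1 + s.2.2.1, s.2.1.2 + s.2.2.2), ⟨(s.2.1.1, s.2.2.1), (s.2.1.2, s.2.2.2)⟩⟩)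
      ?_ ?_ ?_ ?_ ?_ <;>
    · rintro ⟨⟨a, b⟩, ⟨⟨c, d⟩, ⟨e, f⟩⟩⟩
      simp only [Finset.mem_sigma, Finset.HasAntidiagonal.mem_antidiagonal]
      rintro ⟨h1, h2, h3⟩
      subst h2 h3
      first
        | (simp; omega)
        | simp
  map_zero' := by
    ext m; simp
  map_add' x y := by
    ext m; simp [Finset.sum_add_distrib]
  commutes' c := by
    ext m
    change PowerSeries.coeff m (PowerSeries.mk fun m => ∑ p ∈ antidiagonal m,
      PowerSeries.coeff p.2 (ρ (PowerSeries.coeff p.1 (PowerSeries.map (algebraMap k B) c))))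
      = PowerSeries.coeff m (PowerSeries.map (algebraMap k S) c)
    have key : ∀ (a : k) (j : ℕ), PowerSeries.coeff j (ρ (algebraMap k B a))
        = if j = 0 then algebraMap k S a else 0 := by
      intro a j
      rw [AlgHom.commutes, PowerSeries.algebraMap_apply, PowerSeries.coeff_C]
    rw [PowerSeries.coeff_mk, Finset.sum_eq_single (m, 0)]
    · rw [PowerSeries.coeff_map, key, if_pos rfl, PowerSeries.coeff_map]
    · rintro ⟨i, j⟩ hp hne
      have hj : j ≠ 0 := by
        rintro rfl
        apply hne
        simpa using hp
      rw [PowerSeries.coeff_map, key, if_neg hj]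
    · intro hn
      simp at hn

theorem algebraMap_smul_series {k V : Type*} (S : Type*) [Field k] [AddCommGroup V] [Module k V]
    [Semiring S] [Algebra k S] [Module S V] [IsScalarTower k S V] (c : k⟦X⟧) (v : FormalSeries V) :
    algebraMap k⟦X⟧ S⟦X⟧ c • v = c • v := by
  funext m
  change ∑ p ∈ antidiagonal m, PowerSeries.coeff p.1 (PowerSeries.map (algebraMap k S) c) • v p.2
    = ∑ p ∈ antidiagonal m, PowerSeries.coeff p.1 c • v p.2
  simp

/-- The identification of `(End V)⟦h⟧` with an algebra of `k⟦h⟧`-linear endomorphisms of `V⟦h⟧`: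
`(∑ Tᵢ hⁱ) (∑ vⱼ hʲ) = ∑ Tᵢ(vⱼ) hⁱ⁺ʲ`. -/
def seriesEnd (k V : Type*) [Field k] [AddCommGroup V] [Module k V] :
    (Module.End k V)⟦X⟧ →ₐ[k⟦X⟧] Module.End k⟦X⟧ (FormalSeries V) where
  toFun T :=
    { toFun := fun v => T • v
      map_add' := smul_add T
      map_smul' := fun c v => by
        simp only [← algebraMap_smul_series (Module.End k V) c, smul_smul, RingHom.id_apply,
          Algebra.commutes] }
  map_one' := by ext1 v; exact one_smul _ v
  map_mul' S T := by ext1 v; exact mul_smul S T v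
  map_zero' := by ext1 v; exact zero_smul _ v
  map_add' S T := by ext1 v; exact add_smul S T v
  commutes' c := by
    ext1 v; exact algebraMap_smul_series (Module.End k V) c v

end FormalSeries

/-! ## Reduction modulo `h` -/

section Reduction

variable (k : Type*) [Field k]

/-- The two-sided ideal `hA` of a `k⟦h⟧`-algebra `A`. -/
def hIdeal (A : Type*) [Ring A] [Algebra k⟦X⟧ A] : Ideal A :=
  Ideal.span {algebraMap k⟦X⟧ A PowerSeries.X}

instance (A : Type*) [Ring A] [Algebra k⟦X⟧ A] : (hIdeal k A).IsTwoSided where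
  mul_mem_of_left b ha := by
    obtain ⟨c, rfl⟩ := Ideal.mem_span_singleton'.1 ha
    rw [mul_assoc, Algebra.commutes, ← mul_assoc]
    exact Ideal.mul_mem_left _ _ (Ideal.subset_span rfl)

/-- The reduction `A / hA`. -/
def ModH (A : Type*) [Ring A] [Algebra k⟦X⟧ A] : Type _ := A ⧸ hIdeal k A

variable {A A' B₀ A₀ : Type*} [Ring A] [Algebra k⟦X⟧ A] [Ring A'] [Algebra k⟦X⟧ A']
  [Ring B₀] [Algebra k B₀] [Ring A₀] [Algebra k A₀]

instance : Ring (ModH k A) := inferInstanceAs (Ring (A ⧸ hIdeal k A))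

/-- `k` acts on `A / hA` through the constant series. -/
instance : Algebra k (ModH k A) :=
  letI : Algebra k⟦X⟧ (ModH k A) := inferInstanceAs (Algebra k⟦X⟧ (A ⧸ hIdeal k A))
  Algebra.compHom _ (PowerSeries.C : k →+* k⟦X⟧)

end Reduction

/-! ## The Lie algebras `𝔞` and `𝔰𝔩₂`, and their enveloping algebras -/

section LieAlgebras

variable (k : Type*) [Field k]

/-- The generators `H, X⁻, X⁺` of `𝔞`. -/
inductive Gen
  | H
  | Xm
  | Xp

/-- The non-deformed relations `[H, X^±] = ± 2 X^±`. -/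
def nonDeformedRelations : Set (FreeLieAlgebra k Gen) :=
  {⁅FreeLieAlgebra.of k Gen.H, FreeLieAlgebra.of k Gen.Xp⁆ - (2 : k) • FreeLieAlgebra.of k Gen.Xp,
   ⁅FreeLieAlgebra.of k Gen.H, FreeLieAlgebra.of k Gen.Xm⁆ + (2 : k) • FreeLieAlgebra.of k Gen.Xm}

/-- The ideal of the free Lie algebra generated by the non-deformed relations. -/
def nonDeformedIdeal : LieIdeal k (FreeLieAlgebra k Gen) :=
  LieSubmodule.lieSpan k (FreeLieAlgebra k Gen) (nonDeformedRelations k)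

/-- The Lie algebra `𝔞` generated by `H, X⁻, X⁺` subject to `[H, X^±] = ± 2 X^±`. -/
def LieA : Type _ := FreeLieAlgebra k Gen ⧸ nonDeformedIdeal k

instance : LieRing (LieA k) := inferInstanceAs (LieRing (FreeLieAlgebra k Gen ⧸ nonDeformedIdeal k))

instance : LieAlgebra k (LieA k) :=
  inferInstanceAs (LieAlgebra k (FreeLieAlgebra k Gen ⧸ nonDeformedIdeal k))

/-- The generators of `𝔞`. -/
def LieA.gen (g : Gen) : LieA k :=
  (LieSubmodule.Quotient.mk (FreeLieAlgebra.of k g) : FreeLieAlgebra k Gen ⧸ nonDeformedIdeal k)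

variable {k} in
/-- The universal property of `𝔞`. -/
def LieA.lift {L : Type*} [LieRing L] [LieAlgebra k L] (φ : Gen → L)
    (hp : ⁅φ Gen.H, φ Gen.Xp⁆ = (2 : k) • φ Gen.Xp)
    (hm : ⁅φ Gen.H, φ Gen.Xm⁆ = -((2 : k) • φ Gen.Xm)) : LieA k →ₗ⁅k⁆ L :=
  have hker : nonDeformedIdeal k ≤ (FreeLieAlgebra.lift k φ).ker := by
    refine LieSubmodule.lieSpan_le.2 ?_
    rintro x (rfl | rfl)
    · simp [LieHom.mem_ker, hp]
    · simp [LieHom.mem_ker, hm]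
  { (Submodule.liftQ (nonDeformedIdeal k).toSubmodule
      (FreeLieAlgebra.lift k φ : FreeLieAlgebra k Gen →ₗ[k] L)
      (fun x hx => LieHom.mem_ker.1 (hker hx)) : _ →ₗ[k] L) with
    map_lie' := by
      rintro ⟨x⟩ ⟨y⟩
      exact LieHom.map_lie (FreeLieAlgebra.lift k φ) x y }

@[simp]
theorem LieA.lift_gen {L : Type*} [LieRing L] [LieAlgebra k L] (φ : Gen → L)
    (hp : ⁅φ Gen.H, φ Gen.Xp⁆ = (2 : k) • φ Gen.Xp)
    (hm : ⁅φ Gen.H, φ Gen.Xm⁆ = -((2 : k) • φ Gen.Xm)) (g : Gen) :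
    LieA.lift φ hp hm (LieA.gen k g) = φ g :=
  FreeLieAlgebra.lift_of_apply φ g

/-- The Lie algebra `𝔰𝔩₂` of traceless two-by-two matrices. -/
abbrev Sl2 : LieSubalgebra k (Matrix (Fin 2) (Fin 2) k) := LieAlgebra.SpecialLinear.sl (Fin 2) k

/-- The Chevalley generators of `𝔰𝔩₂`. -/
def Sl2.gen : Gen → Sl2 k
  | Gen.H => ⟨!![1, 0; 0, -1], by
      change Matrix.trace (!![1, 0; 0, -1] : Matrix (Fin 2) (Fin 2) k) = 0
      simp [Matrix.trace_fin_two]⟩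
  | Gen.Xm => ⟨!![0, 0; 1, 0], by
      change Matrix.trace (!![0, 0; 1, 0] : Matrix (Fin 2) (Fin 2) k) = 0
      simp [Matrix.trace_fin_two]⟩
  | Gen.Xp => ⟨!![0, 1; 0, 0], by
      change Matrix.trace (!![0, 1; 0, 0] : Matrix (Fin 2) (Fin 2) k) = 0
      simp [Matrix.trace_fin_two]⟩

/-- The projection `𝔞 → 𝔰𝔩₂`. -/
def LieA.toSl2 : LieA k →ₗ⁅k⁆ Sl2 k :=
  LieA.lift (Sl2.gen k)
    (by
      apply Subtype.ext
      rw [LieAlgebra.SpecialLinear.sl_bracket]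
      ext i j
      fin_cases i <;> fin_cases j <;> simp [Sl2.gen, one_add_one_eq_two])
    (by
      apply Subtype.ext
      rw [LieAlgebra.SpecialLinear.sl_bracket]
      ext i j
      fin_cases i <;> fin_cases j <;> simp [Sl2.gen, ← two_mul, sub_eq_add_neg])

/-- The enveloping algebra `U(𝔞)`. -/
abbrev Ua : Type _ := UniversalEnvelopingAlgebra k (LieA k)

/-- The enveloping algebra `U(𝔰𝔩₂)`. -/
abbrev Usl2 : Type _ := UniversalEnvelopingAlgebra k (Sl2 k)

/-- The generators `H, X⁻, X⁺` of `U(𝔞)`. -/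
def Ua.gen (g : Gen) : Ua k := UniversalEnvelopingAlgebra.ι k (LieA.gen k g)

/-- The `𝔞`-algebra structure of `U(𝔰𝔩₂)`, i.e. the homomorphism `U(𝔞) → U(𝔰𝔩₂)` induced by the
projection from `𝔞` to `𝔰𝔩₂`. -/
def Ua.toUsl2 : Ua k →ₐ[k] Usl2 k :=
  UniversalEnvelopingAlgebra.lift k ((UniversalEnvelopingAlgebra.ι k).comp (LieA.toSl2 k))

/-- `U_h(𝔞) = U(𝔞)⟦h⟧`. -/
abbrev Uha : Type _ := (Ua k)⟦X⟧

end LieAlgebras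

/-! ## Formal deformations of a `B₀`-algebra -/

section Deformations

variable {k : Type*} [Field k] {B₀ A₀ A A' : Type*} [Ring B₀] [Algebra k B₀] [Ring A₀]
  [Algebra k A₀] [Ring A] [Algebra k⟦X⟧ A] [Ring A'] [Algebra k⟦X⟧ A']

/-- The `k`-algebra homomorphism `A / hA → A' / hA'` induced by a `k⟦h⟧`-algebra homomorphism
`A → A'`. -/
def modHMap (g : A →ₐ[k⟦X⟧] A') : ModH k A →ₐ[k] ModH k A' where
  __ := (Ideal.Quotient.lift (hIdeal k A) ((Ideal.Quotient.mk (hIdeal k A')).comp (g : A →+* A'))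
    (fun a ha => by
      obtain ⟨c, rfl⟩ := Ideal.mem_span_singleton'.1 ha
      rw [RingHom.comp_apply, Ideal.Quotient.eq_zero_iff_mem, map_mul]
      refine Ideal.mul_mem_left _ _ ?_
      rw [RingHom.coe_coe, AlgHom.commutes]
      exact Ideal.subset_span rfl) : A ⧸ hIdeal k A →+* A' ⧸ hIdeal k A')
  commutes' c := by
    change Ideal.Quotient.mk (hIdeal k A') (g (algebraMap k⟦X⟧ A (PowerSeries.C c)))
      = Ideal.Quotient.mk (hIdeal k A') (algebraMap k⟦X⟧ A' (PowerSeries.C c))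
    rw [AlgHom.commutes]

/-- The `B₀`-algebra structure `B₀ → A / hA` induced by a `B₀⟦h⟧`-algebra structure
`f : B₀⟦h⟧ → A`; it sends `b` to the class of `f(b)`. -/
def modHStructure (f : B₀⟦X⟧ →ₐ[k⟦X⟧] A) : B₀ →ₐ[k] ModH k A where
  __ := ((Ideal.Quotient.mk (hIdeal k A)).comp
    ((f : B₀⟦X⟧ →+* A).comp (PowerSeries.C : B₀ →+* B₀⟦X⟧)) : B₀ →+* A ⧸ hIdeal k A)
  commutes' c := by
    change Ideal.Quotient.mk (hIdeal k A) (f (PowerSeries.C (algebraMap k B₀ c)))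
      = Ideal.Quotient.mk (hIdeal k A) (algebraMap k⟦X⟧ A (PowerSeries.C c))
    rw [← AlgHom.commutes f]
    congr 2
    change _ = PowerSeries.map (algebraMap k B₀) (PowerSeries.C c)
    simp

/-- Let `p : B₀ → A₀` be a `B₀`-algebra. The `B₀⟦h⟧`-algebra `f : B₀⟦h⟧ → A` is a formal
deformation of the `B₀`-algebra `A₀` if `A` is a topologically free `k⟦h⟧`-module and if `A / hA`
and `A₀` are isomorphic as `B₀`-algebras. -/
structure IsFormalDeformation (p : B₀ →ₐ[k] A₀) (f : B₀⟦X⟧ →ₐ[k⟦X⟧] A) : Prop where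
  topologicallyFree : IsTopologicallyFree k A
  reduction : ∃ e : ModH k A ≃ₐ[k] A₀, ∀ b : B₀, e (modHStructure f b) = p b

end Deformations

section HTrivial

variable {k : Type*} [Field k] {A : Type*} [Ring A] [Algebra k⟦X⟧ A]

/-- The `k⟦h⟧`-algebra isomorphism `g : U(𝔰𝔩₂)⟦h⟧ → A` is an `𝔥`-trivialization of the
`U_h(𝔞)`-algebra `f : U_h(𝔞) → A` if `g(H) = H` and if `g` modulo `h` is an isomorphism of
`𝔞`-algebras. -/
structure IsHTrivialization (f : Uha k →ₐ[k⟦X⟧] A) (g : (Usl2 k)⟦X⟧ ≃ₐ[k⟦X⟧] A) : Prop where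
  map_H : g (PowerSeries.C (Ua.toUsl2 k (Ua.gen k Gen.H))) = f (PowerSeries.C (Ua.gen k Gen.H))
  modH_bijective : Function.Bijective (modHMap (g : (Usl2 k)⟦X⟧ →ₐ[k⟦X⟧] A))
  modH_structure : ∀ x : Ua k, modHMap (g : (Usl2 k)⟦X⟧ →ₐ[k⟦X⟧] A)
    (modHStructure (mapSeries (Ua.toUsl2 k)) x) = modHStructure f x

/-- The `U_h(𝔞)`-algebra `f : U_h(𝔞) → A` is an `𝔥`-trivial formal deformation of the
`𝔞`-algebra `U(𝔰𝔩₂)`. -/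
structure IsHTrivialDeformation (f : Uha k →ₐ[k⟦X⟧] A) : Prop where
  deformation : IsFormalDeformation (Ua.toUsl2 k) f
  trivial : ∃ g : (Usl2 k)⟦X⟧ ≃ₐ[k⟦X⟧] A, IsHTrivialization f g

end HTrivial

/-! ## Colourings and the algebras `U_h(ψ)` -/

section Colourings

/-- A colouring: a family `ψᵏ(n)` of formal power series, for `k ≥ 1` and `n ∈ ℤ`, such that
* `ψᵏ(n) = k (n - k + 1)` modulo `h`,
* `ψⁿ⁺¹(n) = 0` for `n ≥ 0`,
* `ψⁿ⁺ᵏ⁺¹(n) = ψᵏ(-n-2)` for `k ≥ 1` and `n ≥ 0`. -/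
@[ext]
structure Colouring (K : Type*) [Field K] where
  /-- `toFun k n` is `ψᵏ(n)`. -/
  toFun : ℕ+ → ℤ → K⟦X⟧
  constantCoeff_eq : ∀ (k : ℕ+) (n : ℤ),
    PowerSeries.constantCoeff (toFun k n) = (k : K) * ((n : K) - (k : K) + 1)
  eq_zero : ∀ n : ℕ, toFun (Nat.succPNat n) n = 0
  eq_shift : ∀ (k : ℕ+) (n : ℕ), toFun (Nat.succPNat (n + k)) n = toFun k (-(n : ℤ) - 2)

variable {K : Type*} [Field K]

/-- A colouring is regular if `ψᵏ(n) ∈ K[k,n]⟦h⟧`: every coefficient of `ψᵏ(n)` depends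
polynomially on `k` and `n`. -/
def Colouring.IsRegular (ψ : Colouring K) : Prop :=
  ∀ m : ℕ, ∃ P : MvPolynomial (Fin 2) K, ∀ (k : ℕ+) (n : ℤ),
    PowerSeries.coeff m (ψ.toFun k n) = MvPolynomial.eval ![(k : K), (n : K)] P

/-- The space `⨁_{k ≥ 0} K b_k` underlying Verma modules; `b_k` is `Finsupp.single k 1`. -/
abbrev VermaSpace (K : Type*) [Field K] : Type _ := ℕ →₀ K

/-- The action of the generators on the deformed Verma module of highest weight `n`, as series
with coefficients in `End (⨁ K b_k)`:
`H b_k = (n - 2k) b_k`, `X⁻ b_k = b_{k+1}`, `X⁺ b_0 = 0`, `X⁺ b_{k+1} = ψᵏ⁺¹(n) b_k`. -/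
def Colouring.genAction (ψ : Colouring K) (n : ℤ) : Gen → (Module.End K (VermaSpace K))⟦X⟧
  | Gen.H => PowerSeries.C
      (Finsupp.linearCombination K fun k : ℕ => Finsupp.single k ((n : K) - 2 * (k : K)))
  | Gen.Xm => PowerSeries.C
      (Finsupp.linearCombination K fun k : ℕ => Finsupp.single (k + 1) (1 : K))
  | Gen.Xp => PowerSeries.mk fun m =>
      Finsupp.linearCombination K fun k : ℕ => match k with
        | 0 => 0
        | j + 1 => Finsupp.single j (PowerSeries.coeff m (ψ.toFun (Nat.succPNat j) n))

/-- The homomorphism `U(𝔞) → (End (⨁ K b_k))⟦h⟧` given by the action of the generators. -/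
def Colouring.UaAction (ψ : Colouring K) (n : ℤ) :
    Ua K →ₐ[K] (Module.End K (VermaSpace K))⟦X⟧ :=
  UniversalEnvelopingAlgebra.lift K (LieA.lift (ψ.genAction n)
    (by
      rw [Ring.lie_def]
      refine PowerSeries.ext fun m => Finsupp.lhom_ext' fun k => LinearMap.ext_ring ?_
      simp only [Colouring.genAction, map_sub, PowerSeries.coeff_C_mul, PowerSeries.coeff_mul_C,
        PowerSeries.coeff_smul, PowerSeries.coeff_mk]
      rcases k with _ | k
      · simp [Module.End.mul_apply]
      · refine Finsupp.ext fun j => ?_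
        simp only [Module.End.mul_apply, LinearMap.sub_apply, LinearMap.smul_apply,
          LinearMap.comp_apply, Finsupp.lsingle_apply, Finsupp.linearCombination_single, one_smul,
          Finsupp.smul_single, Finsupp.sub_apply, Finsupp.single_apply, smul_eq_mul]
        split_ifs <;> push_cast <;> ring)
    (by
      rw [Ring.lie_def]
      refine PowerSeries.ext fun m => Finsupp.lhom_ext' fun k => LinearMap.ext_ring ?_
      simp only [Colouring.genAction, map_sub, map_neg, PowerSeries.coeff_smul,
        PowerSeries.coeff_mul_C, PowerSeries.coeff_C]
      split_ifs with h
      · refine Finsupp.ext fun j => ?_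
        simp only [Module.End.mul_apply, LinearMap.sub_apply, LinearMap.smul_apply,
          LinearMap.neg_apply, LinearMap.comp_apply, Finsupp.lsingle_apply,
          Finsupp.linearCombination_single, one_smul, Finsupp.smul_single, Finsupp.sub_apply,
          Finsupp.neg_apply, Finsupp.single_apply, smul_eq_mul]
        split_ifs <;> push_cast <;> ring
      · simp))

/-- The representation of `U_h(𝔞)` on `V(n, ψ) = (⨁ K b_k)⟦h⟧`. -/
def Colouring.verma (ψ : Colouring K) (n : ℤ) :
    Uha K →ₐ[K⟦X⟧] Module.End K⟦X⟧ (FormalSeries (VermaSpace K)) :=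
  (seriesEnd K (VermaSpace K)).comp (extendSeries (ψ.UaAction n))

/-- The two-sided ideal `I_h(ψ)` of `U_h(𝔞)` formed by the elements acting by zero on `V(n, ψ)`
for all `n ∈ ℤ`. -/
def Colouring.ideal (ψ : Colouring K) : Ideal (Uha K) :=
  ⨅ n : ℤ, RingHom.ker (ψ.verma n)

instance (ψ : Colouring K) : ψ.ideal.IsTwoSided :=
  inferInstanceAs (⨅ n : ℤ, RingHom.ker (ψ.verma n)).IsTwoSided

/-- The algebra `U_h(ψ) = U_h(𝔞) / I_h(ψ)`. -/
abbrev Colouring.Uh (ψ : Colouring K) : Type _ := Uha K ⧸ ψ.ideal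

/-- The `U_h(𝔞)`-algebra structure of `U_h(ψ)`, i.e. the projection `U_h(𝔞) → U_h(ψ)`. -/
def Colouring.proj (ψ : Colouring K) : Uha K →ₐ[K⟦X⟧] ψ.Uh :=
  Ideal.Quotient.mkₐ K⟦X⟧ ψ.ideal

end Colourings

end ColouredKM

end

open ColouredKM

/-!
An `𝔥`-trivialization identifies a deformation with a homomorphism `F : U_h(𝔞) → U(𝔰𝔩₂)⟦h⟧` which
fixes `H` and reduces modulo `h` to the projection `U(𝔞) → U(𝔰𝔩₂)`. Such an `F` is surjective
(`surjective_of_constantCoeff`), so everything depends on its kernel. Since `U(𝔰𝔩₂)` acts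
faithfully on the sum of its Verma modules `M(n)`, `n ∈ ℤ` (`classicalVerma_faithful`), the kernel
consists of the elements which act by zero, through `F`, on all `M(n)⟦h⟧`.

*From deformations to colourings* (`exists_colouring`). For weight reasons `F(X⁺)` and `F(X⁻)` act
on `M(n)⟦h⟧` by `b_k ↦ c(k, n) b_{k-1}` and `b_k ↦ d(k, n) b_{k+1}`, with `d(k, n) ≡ 1` modulo `h`,
and a diagonal change of basis (`exists_conj`) turns `M(n)⟦h⟧` into `V(n, ψ)` for
`ψᵏ(n) = c(k, n) d(k-1, n)`. The coefficients of these series are polynomial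
(`classicalVerma_coeff_polynomial`), and the symmetries required of a colouring express that
`b_k ↦ b_{n+1+k}` is a homomorphism
`M(-n-2) → M(n)` for `n ≥ 0` (`classicalVerma_shift`). Hence `ker F = I_h(ψ)` with `ψ` regular.

*From colourings to deformations* (`exists_hom_of_isRegular`). Put `μ = n - 2k` and `ν = n + 1`.
The symmetries of a colouring say that the coefficients of `ψᵏ(n)`, which are polynomials in `k`
and `n`, are even in `ν` and vanish for `ν² = (μ + 1)²`; they are therefore of the form
`k (n - k + 1) Q(μ, ν²)` (`exists_quotient`). As `μ` and `ν²` are the eigenvalues on `b_k` of `H`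
and of an element of the centre of `U(𝔰𝔩₂)`, there are elements of `U(𝔰𝔩₂)` acting by
`b_k ↦ k (n - k + 1) Q(μ, ν²) b_{k-1}` on all `M(n)` (`exists_realisation`). They are the
coefficients of `F(X⁺)` for a homomorphism `F` with kernel `I_h(ψ)`.

*Uniqueness* (`colouring_eq_of_ideal_eq`). An isomorphism `U_h(ψ) ≃ U_h(ψ')` of `U_h(𝔞)`-algebras
forces `I_h(ψ) = I_h(ψ')`, so that `U(𝔰𝔩₂)⟦h⟧` acts on `V(n, ψ')`. There `b_0` is killed by `X⁺`
and `H - n`, which generate the annihilator of the highest weight vector of `M(n)`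
(`mem_span_of_classicalVerma_eq_zero`). Therefore `X⁺ (X⁻)ᵏ - ψᵏ(n) (X⁻)ᵏ⁻¹`, which kills the
highest weight vector of `V(n, ψ)`, also kills that of `V(n, ψ')`.
-/

open scoped PowerSeries
open Finset.HasAntidiagonal (antidiagonal)

noncomputable section

namespace ColouredKM

universe v

attribute [local instance 100] LieRing.ofAssociativeRing

/-! ### Algebras and modules of formal series -/

section Series

variable {k : Type*} [Field k]

theorem seriesAlgebra_algebraMap {B : Type*} [Semiring B] [Algebra k B] (c : k⟦X⟧) :
    algebraMap k⟦X⟧ B⟦X⟧ c = PowerSeries.map (algebraMap k B) c := rfl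

theorem X_smul_eq {B : Type*} [Semiring B] [Algebra k B] (x : B⟦X⟧) :
    (PowerSeries.X : k⟦X⟧) • x = PowerSeries.X * x := by
  rw [Algebra.smul_def, seriesAlgebra_algebraMap, PowerSeries.map_X]

theorem FormalSeries.X_smul_zero {V : Type*} [AddCommGroup V] [Module k V] (v : FormalSeries V) :
    ((PowerSeries.X : k⟦X⟧) • v) 0 = 0 := by
  simp [FormalSeries.smul_apply]

theorem FormalSeries.X_smul_succ {V : Type*} [AddCommGroup V] [Module k V] (v : FormalSeries V)
    (m : ℕ) : ((PowerSeries.X : k⟦X⟧) • v) (m + 1) = v m := by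
  rw [FormalSeries.smul_apply, Finset.sum_eq_single (1, m)]
  · simp
  · rintro ⟨i, j⟩ hp hne
    have hi : i ≠ 1 := by
      rintro rfl
      apply hne
      simp only [Finset.HasAntidiagonal.mem_antidiagonal] at hp
      simp only [Prod.mk.injEq, true_and]
      omega
    simp [PowerSeries.coeff_X, hi]
  · intro hn
    simp [add_comm] at hn

/-- A `k⟦h⟧`-linear map out of `B⟦h⟧` with values in a module of series is automatically
`h`-adically continuous: it kills a series as soon as it kills its coefficients. -/
theorem linearMap_eq_zero {B V : Type*} [Semiring B] [Algebra k B] [AddCommGroup V] [Module k V]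
    (T : B⟦X⟧ →ₗ[k⟦X⟧] FormalSeries V) (z : B⟦X⟧)
    (hz : ∀ m, T (PowerSeries.C (PowerSeries.coeff m z)) = 0) : T z = 0 := by
  have key : ∀ m (z : B⟦X⟧), (∀ m, T (PowerSeries.C (PowerSeries.coeff m z)) = 0) →
      T z m = 0 := by
    intro m
    induction m with
    | zero =>
      intro z hz
      rw [PowerSeries.eq_X_mul_shift_add_const z, ← X_smul_eq (k := k), map_add, map_smul]
      have := hz 0
      rw [PowerSeries.coeff_zero_eq_constantCoeff_apply] at this
      rw [this, add_zero, FormalSeries.X_smul_zero]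
    | succ m ih =>
      intro z hz
      have h0 := hz 0
      rw [PowerSeries.coeff_zero_eq_constantCoeff_apply] at h0
      rw [PowerSeries.eq_X_mul_shift_add_const z, ← X_smul_eq (k := k), map_add, map_smul, h0,
        add_zero, FormalSeries.X_smul_succ]
      apply ih
      intro j
      rw [PowerSeries.coeff_mk]
      exact hz _
  funext m
  exact key m z hz

/-- Series with coefficients in an algebra, seen as a module of series. -/
def toFormalSeries (k S : Type*) [Field k] [Ring S] [Algebra k S] :
    S⟦X⟧ ≃ₗ[k⟦X⟧] FormalSeries S where
  toFun x := fun m => PowerSeries.coeff m x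
  invFun v := PowerSeries.mk v
  left_inv x := by ext m; simp
  right_inv v := by funext m; exact PowerSeries.coeff_mk m v
  map_add' x y := by funext m; exact map_add _ _ _
  map_smul' c x := by
    funext m
    change PowerSeries.coeff m (c • x) = ∑ p ∈ antidiagonal m,
      PowerSeries.coeff p.1 c • PowerSeries.coeff p.2 x
    rw [Algebra.smul_def, seriesAlgebra_algebraMap, PowerSeries.coeff_mul]
    simp [Algebra.smul_def]

/-- Homomorphisms between algebras of series are determined by their values on constants. -/
theorem algHom_ext_C {B S : Type*} [Semiring B] [Algebra k B] [Semiring S] [Algebra k S]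
    {F G : B⟦X⟧ →ₐ[k⟦X⟧] S⟦X⟧} (h : ∀ b, F (PowerSeries.C b) = G (PowerSeries.C b)) : F = G := by
  have key : ∀ m z, PowerSeries.coeff m (F z) = PowerSeries.coeff m (G z) := by
    intro m
    induction m with
    | zero =>
      intro z
      rw [PowerSeries.eq_X_mul_shift_add_const z, ← X_smul_eq (k := k), map_add F, map_add G,
        map_smul, map_smul, h, X_smul_eq, X_smul_eq]
      simp
    | succ m ih =>
      intro z
      rw [PowerSeries.eq_X_mul_shift_add_const z, ← X_smul_eq (k := k), map_add F, map_add G,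
        map_smul, map_smul, h, X_smul_eq, X_smul_eq, map_add, map_add,
        PowerSeries.coeff_succ_X_mul, PowerSeries.coeff_succ_X_mul, ih]
  exact AlgHom.ext fun z => PowerSeries.ext fun m => key m z

theorem extendSeries_C {B S : Type*} [Semiring B] [Algebra k B] [Semiring S] [Algebra k S]
    (ρ : B →ₐ[k] S⟦X⟧) (b : B) : extendSeries ρ (PowerSeries.C b) = ρ b := by
  ext m
  change PowerSeries.coeff m (PowerSeries.mk fun m => ∑ p ∈ antidiagonal m,
      PowerSeries.coeff p.2 (ρ (PowerSeries.coeff p.1 (PowerSeries.C b)))) = _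
  rw [PowerSeries.coeff_mk, Finset.sum_eq_single (0, m)]
  · simp
  · rintro ⟨i, j⟩ hp hne
    have hi : i ≠ 0 := by
      rintro rfl
      apply hne
      simpa using hp
    simp [PowerSeries.coeff_C, hi]
  · intro hn
    simp at hn

theorem mapSeries_coeff {B S : Type*} [Semiring B] [Algebra k B] [Semiring S] [Algebra k S]
    (f : B →ₐ[k] S) (x : B⟦X⟧) (m : ℕ) :
    PowerSeries.coeff m (mapSeries f x) = f (PowerSeries.coeff m x) :=
  PowerSeries.coeff_map (f : B →+* S) m x

theorem mapSeries_C {B S : Type*} [Semiring B] [Algebra k B] [Semiring S] [Algebra k S]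
    (f : B →ₐ[k] S) (b : B) : mapSeries f (PowerSeries.C b) = PowerSeries.C (f b) :=
  PowerSeries.map_C (f : B →+* S) b

/-- A scalar of `k` acts on `S⟦h⟧` in the same way through `k` and through `k⟦h⟧`. -/
theorem C_algebraMap {S : Type*} [Semiring S] [Algebra k S] (c : k) :
    algebraMap k⟦X⟧ S⟦X⟧ (PowerSeries.C c) = algebraMap k S⟦X⟧ c := by
  rw [seriesAlgebra_algebraMap, PowerSeries.map_C, PowerSeries.algebraMap_apply]

/-- The restriction to constants of a homomorphism between algebras of series. -/
def restrictC {B S : Type*} [Semiring B] [Algebra k B] [Semiring S] [Algebra k S]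
    (F : B⟦X⟧ →ₐ[k⟦X⟧] S⟦X⟧) : B →ₐ[k] S⟦X⟧ where
  __ := (F : B⟦X⟧ →+* S⟦X⟧).comp (PowerSeries.C : B →+* B⟦X⟧)
  commutes' c := by
    change F (PowerSeries.C (algebraMap k B c)) = _
    rw [← C_algebraMap, ← AlgHom.commutes F, seriesAlgebra_algebraMap, PowerSeries.map_C]

theorem restrictC_apply {B S : Type*} [Semiring B] [Algebra k B] [Semiring S] [Algebra k S]
    (F : B⟦X⟧ →ₐ[k⟦X⟧] S⟦X⟧) (b : B) : restrictC F b = F (PowerSeries.C b) := rfl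

theorem extendSeries_restrictC {B S : Type*} [Semiring B] [Algebra k B] [Semiring S] [Algebra k S]
    (F : B⟦X⟧ →ₐ[k⟦X⟧] S⟦X⟧) : extendSeries (restrictC F) = F :=
  algHom_ext_C fun b => by rw [extendSeries_C, restrictC_apply]

/-- The remainders of the successive approximation of `y` by values of `F`, for a set-theoretic
section `s` of `F` modulo `h`. -/
def approxRemainder {B S : Type*} [Ring B] [Ring S] (F : B⟦X⟧ → S⟦X⟧) (s : S → B) (y : S⟦X⟧) :
    ℕ → S⟦X⟧
  | 0 => y
  | m + 1 => PowerSeries.mk fun j => PowerSeries.coeff (j + 1) (approxRemainder F s y m -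
      F (PowerSeries.C (s (PowerSeries.constantCoeff (approxRemainder F s y m)))))

/-- A homomorphism between algebras of series which is surjective modulo `h` is surjective. -/
theorem surjective_of_constantCoeff {B S : Type*} [Ring B] [Algebra k B] [Ring S] [Algebra k S]
    (F : B⟦X⟧ →ₐ[k⟦X⟧] S⟦X⟧) (p : B → S) (hp : Function.Surjective p)
    (hF : ∀ b, PowerSeries.constantCoeff (F (PowerSeries.C b)) = p b) : Function.Surjective F := by
  intro y
  obtain ⟨s, hs⟩ := hp.hasRightInverse
  -- `x i` is the preimage of the remainder `r i` assembled from all later approximations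
  let r := approxRemainder F s y
  let x : ℕ → B⟦X⟧ := fun i =>
    PowerSeries.mk fun m => s (PowerSeries.constantCoeff (r (i + m)))
  have hx : ∀ i, x i = PowerSeries.X * x (i + 1)
      + PowerSeries.C (s (PowerSeries.constantCoeff (r i))) := by
    intro i
    ext (_ | m)
    · simp [x]
    · simp [x, PowerSeries.coeff_succ_X_mul, Nat.add_right_comm, Nat.add_assoc]
  have hr : ∀ i, r i = PowerSeries.X * r (i + 1)
      + F (PowerSeries.C (s (PowerSeries.constantCoeff (r i)))) := by
    intro i
    ext (_ | m)
    · simp [hF, hs _]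
    · simp only [map_add, PowerSeries.coeff_succ_X_mul]
      change _ = PowerSeries.coeff m (PowerSeries.mk fun j => PowerSeries.coeff (j + 1) (r i -
        F (PowerSeries.C (s (PowerSeries.constantCoeff (r i)))))) + _
      simp
  have key : ∀ m i, PowerSeries.coeff m (F (x i)) = PowerSeries.coeff m (r i) := by
    intro m
    induction m with
    | zero =>
      intro i
      refine Eq.trans ?_ (congrArg _ (hr i)).symm
      rw [hx i, ← X_smul_eq (k := k), map_add, map_smul, X_smul_eq]
      simp
    | succ m ih =>
      intro i
      refine Eq.trans ?_ (congrArg _ (hr i)).symm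
      rw [hx i, ← X_smul_eq (k := k), map_add, map_smul, X_smul_eq]
      simp only [map_add, PowerSeries.coeff_succ_X_mul, ih]
  exact ⟨x 0, PowerSeries.ext fun m => key m 0⟩

theorem isTopologicallyFree_of_equiv {A S : Type v} [Ring A] [Algebra k⟦X⟧ A] [Ring S]
    [Algebra k S] (g : S⟦X⟧ ≃ₐ[k⟦X⟧] A) : IsTopologicallyFree k A :=
  ⟨S, inferInstance, inferInstance, ⟨g.symm.toLinearEquiv.trans (toFormalSeries k S)⟩⟩

theorem mem_hIdeal_iff {S : Type*} [Ring S] [Algebra k S] (x : S⟦X⟧) :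
    x ∈ hIdeal k S⟦X⟧ ↔ PowerSeries.constantCoeff x = 0 := by
  rw [hIdeal, Ideal.mem_span_singleton', seriesAlgebra_algebraMap, PowerSeries.map_X]
  constructor
  · rintro ⟨a, rfl⟩
    simp
  · intro h
    refine ⟨PowerSeries.mk fun p => PowerSeries.coeff (p + 1) x, ?_⟩
    conv_rhs => rw [PowerSeries.eq_shift_mul_X_add_const x, h, map_zero, add_zero]

/-- The identification of `S⟦h⟧ / h S⟦h⟧` with `S`. -/
def modHSeries (k S : Type*) [Field k] [Ring S] [Algebra k S] : ModH k S⟦X⟧ ≃ₐ[k] S :=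
  AlgEquiv.ofBijective
    { __ := (Ideal.Quotient.lift (hIdeal k S⟦X⟧) (PowerSeries.constantCoeff : S⟦X⟧ →+* S)
        (fun a ha => (mem_hIdeal_iff (k := k) a).1 ha) : S⟦X⟧ ⧸ hIdeal k S⟦X⟧ →+* S)
      commutes' := fun c => by
        change PowerSeries.constantCoeff (algebraMap k⟦X⟧ S⟦X⟧ (PowerSeries.C c)) = _
        rw [seriesAlgebra_algebraMap, PowerSeries.map_C, PowerSeries.constantCoeff_C] }
    (by
      constructor
      · rw [injective_iff_map_eq_zero]
        intro a
        obtain ⟨a, rfl⟩ := Ideal.Quotient.mk_surjective a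
        intro h
        exact Ideal.Quotient.eq_zero_iff_mem.2 ((mem_hIdeal_iff (k := k) a).2 h)
      · intro s
        exact ⟨Ideal.Quotient.mk _ (PowerSeries.C s), PowerSeries.constantCoeff_C s⟩)

theorem modHSeries_mk {S : Type*} [Ring S] [Algebra k S] (x : S⟦X⟧) :
    modHSeries k S (Ideal.Quotient.mk (hIdeal k S⟦X⟧) x) = PowerSeries.constantCoeff x := rfl

/-- An isomorphism of `k⟦h⟧`-algebras is an isomorphism modulo `h`. -/
def modHEquiv {A A' : Type*} [Ring A] [Algebra k⟦X⟧ A] [Ring A'] [Algebra k⟦X⟧ A']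
    (g : A ≃ₐ[k⟦X⟧] A') : ModH k A ≃ₐ[k] ModH k A' :=
  AlgEquiv.ofAlgHom (modHMap (g : A →ₐ[k⟦X⟧] A')) (modHMap (g.symm : A' →ₐ[k⟦X⟧] A))
    (by
      apply AlgHom.ext
      intro a
      obtain ⟨a, rfl⟩ := Ideal.Quotient.mk_surjective a
      change Ideal.Quotient.mk _ (g (g.symm a)) = Ideal.Quotient.mk _ a
      rw [AlgEquiv.apply_symm_apply])
    (by
      apply AlgHom.ext
      intro a
      obtain ⟨a, rfl⟩ := Ideal.Quotient.mk_surjective a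
      change Ideal.Quotient.mk _ (g.symm (g a)) = Ideal.Quotient.mk _ a
      rw [AlgEquiv.symm_apply_apply])

theorem modHEquiv_apply {A A' : Type*} [Ring A] [Algebra k⟦X⟧ A] [Ring A'] [Algebra k⟦X⟧ A']
    (g : A ≃ₐ[k⟦X⟧] A') (a : ModH k A) :
    modHEquiv g a = modHMap (g : A →ₐ[k⟦X⟧] A') a := rfl

/-- A homomorphism factors through a surjection of which it kills the kernel. The target `S` is
only a semiring because `(End V)⟦h⟧` carries the semiring structure coming from `End V`. -/
theorem exists_factor {R A B S : Type*} [CommSemiring R] [Ring A] [Algebra R A] [Ring B]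
    [Algebra R B] [Semiring S] [Algebra R S] (F : A →ₐ[R] B) (hF : Function.Surjective F)
    (G : A →ₐ[R] S) (h : ∀ x, F x = 0 → G x = 0) : ∃ τ : B →ₐ[R] S, ∀ x, τ (F x) = G x := by
  refine ⟨(Ideal.Quotient.liftₐ (RingHom.ker F) G h).comp
    ((Ideal.quotientKerAlgEquivOfSurjective hF).symm : B →ₐ[R] A ⧸ RingHom.ker F), fun x => ?_⟩
  rw [AlgHom.comp_apply, AlgEquiv.coe_toAlgHom,
    Ideal.quotientKerAlgEquivOfSurjective_symm_apply]
  rfl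

end Series

/-! ### Monomial operators on Verma modules -/

section MonomialOperators

variable {K : Type*} [Field K]

/-- The operator `b_i ↦ c(i) b_{σ(i)}`. -/
def monoEnd (σ : ℕ → ℕ) (c : ℕ → K) : Module.End K (VermaSpace K) :=
  Finsupp.linearCombination K fun i => Finsupp.single (σ i) (c i)

theorem monoEnd_single (σ : ℕ → ℕ) (c : ℕ → K) (i : ℕ) (a : K) :
    monoEnd σ c (Finsupp.single i a) = Finsupp.single (σ i) (a * c i) := by
  simp [monoEnd]

theorem vermaEnd_ext {S T : Module.End K (VermaSpace K)}
    (h : ∀ i, S (Finsupp.single i 1) = T (Finsupp.single i 1)) : S = T :=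
  Finsupp.lhom_ext' fun i => LinearMap.ext_ring (h i)

theorem monoEnd_mul (σ τ : ℕ → ℕ) (c d : ℕ → K) :
    monoEnd σ c * monoEnd τ d = monoEnd (σ ∘ τ) fun i => c (τ i) * d i :=
  vermaEnd_ext fun i => by simp [monoEnd_single, mul_comm]

/-- The operator `b_i ↦ c(i) b_{σ(i)}`, for series `c(i)`, as a series of operators. -/
def mono (σ : ℕ → ℕ) (c : ℕ → K⟦X⟧) : (Module.End K (VermaSpace K))⟦X⟧ :=
  PowerSeries.mk fun m => monoEnd σ fun i => PowerSeries.coeff m (c i)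

theorem coeff_mono (σ : ℕ → ℕ) (c : ℕ → K⟦X⟧) (m : ℕ) :
    PowerSeries.coeff m (mono σ c) = monoEnd σ fun i => PowerSeries.coeff m (c i) :=
  PowerSeries.coeff_mk _ _

theorem mono_mul (σ τ : ℕ → ℕ) (c d : ℕ → K⟦X⟧) :
    mono σ c * mono τ d = mono (σ ∘ τ) fun i => c (τ i) * d i := by
  ext1 m
  simp only [PowerSeries.coeff_mul, coeff_mono, monoEnd_mul]
  refine vermaEnd_ext fun i => ?_
  simp [LinearMap.sum_apply, monoEnd_single, Finsupp.single_finsetSum]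

theorem mono_id_one : mono (K := K) id (fun _ => 1) = 1 := by
  ext1 m
  rw [coeff_mono]
  refine vermaEnd_ext fun i => ?_
  by_cases hm : m = 0 <;> simp [monoEnd_single, PowerSeries.coeff_one, hm]

theorem C_monoEnd (σ : ℕ → ℕ) (c : ℕ → K) :
    PowerSeries.C (monoEnd σ c) = mono σ fun i => PowerSeries.C (c i) := by
  ext1 m
  rw [coeff_mono]
  refine vermaEnd_ext fun i => ?_
  by_cases hm : m = 0 <;> simp [monoEnd_single, PowerSeries.coeff_C, hm]

namespace Colouring

variable (ψ : Colouring K) (n : ℤ)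

/-- The coefficients of the action of `X⁺` on `V(n, ψ)`, extended by `0` at `k = 0`. -/
def coef : ℕ → K⟦X⟧
  | 0 => 0
  | i + 1 => ψ.toFun (Nat.succPNat i) n

theorem genAction_H : ψ.genAction n Gen.H =
    mono id fun i => PowerSeries.C ((n : K) - 2 * (i : K)) := by
  rw [← C_monoEnd]; rfl

theorem genAction_Xm : ψ.genAction n Gen.Xm = mono Nat.succ fun _ => 1 := by
  rw [← map_one PowerSeries.C, ← C_monoEnd]; rfl

theorem genAction_Xp : ψ.genAction n Gen.Xp = mono Nat.pred (ψ.coef n) := by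
  ext1 m
  rw [coeff_mono]
  simp only [genAction, PowerSeries.coeff_mk]
  refine vermaEnd_ext fun i => ?_
  cases i <;> simp [monoEnd_single, coef]

theorem UaAction_gen (g : Gen) : ψ.UaAction n (Ua.gen K g) = ψ.genAction n g := by
  rw [UaAction, Ua.gen, UniversalEnvelopingAlgebra.lift_ι_apply, LieA.lift_gen]

end Colouring

/-- A vector of `V`, seen as a constant series. -/
def constSeries {V : Type*} [AddCommGroup V] (v : V) : FormalSeries V :=
  fun j => if j = 0 then v else 0

/-- Evaluation at a constant series `v` reads off the values at `v` of all coefficients. -/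
theorem seriesEnd_constSeries {V : Type*} [AddCommGroup V] [Module K V]
    (T : (Module.End K V)⟦X⟧) (v : V) (m : ℕ) :
    seriesEnd K V T (constSeries v) m = PowerSeries.coeff m T v := by
  change ∑ p ∈ antidiagonal m, PowerSeries.coeff p.1 T • (if p.2 = 0 then v else 0) = _
  rw [Finset.sum_eq_single (m, 0)]
  · simp
  · rintro ⟨i, j⟩ hp hne
    have hj : j ≠ 0 := by
      rintro rfl
      apply hne
      simpa using hp
    simp [hj]
  · intro hn
    simp at hn

theorem seriesEnd_injective {V : Type*} [AddCommGroup V] [Module K V] :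
    Function.Injective (seriesEnd K V) := by
  rw [injective_iff_map_eq_zero]
  intro T hT
  ext m v
  rw [← seriesEnd_constSeries, hT]
  rfl

theorem Colouring.mem_ideal_iff (ψ : Colouring K) (x : Uha K) :
    x ∈ ψ.ideal ↔ ∀ n, extendSeries (ψ.UaAction n) x = 0 := by
  rw [Colouring.ideal, Ideal.mem_iInf]
  refine forall_congr' fun n => ?_
  rw [RingHom.mem_ker]
  change seriesEnd K (VermaSpace K) (extendSeries (ψ.UaAction n) x) = 0 ↔ _
  rw [map_eq_zero_iff _ seriesEnd_injective]

/-- Conjugation `x ↦ d' x d`, for `d` and `d'` inverse to each other. -/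
def conjHom {R S : Type*} [CommSemiring R] [Semiring S] [Algebra R S] (d d' : S)
    (h : d * d' = 1) (h' : d' * d = 1) : S →ₐ[R] S where
  toFun x := d' * x * d
  map_one' := by rw [mul_one, h']
  map_mul' x y := by
    rw [show d' * x * d * (d' * y * d) = d' * x * (d * d') * y * d by simp only [mul_assoc], h,
      mul_one, mul_assoc d' x y]
  map_zero' := by simp
  map_add' x y := by rw [mul_add, add_mul]
  commutes' r := by rw [← Algebra.commutes, mul_assoc, h', mul_one]

theorem conjHom_apply {R S : Type*} [CommSemiring R] [Semiring S] [Algebra R S] (d d' : S)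
    (h : d * d' = 1) (h' : d' * d = 1) (x : S) :
    conjHom (R := R) d d' h h' x = d' * x * d := rfl

theorem conjHom_injective {R S : Type*} [CommSemiring R] [Semiring S] [Algebra R S] (d d' : S)
    (h : d * d' = 1) (h' : d' * d = 1) : Function.Injective (conjHom (R := R) d d' h h') := by
  intro x y hxy
  simp only [conjHom_apply] at hxy
  calc x = (d * d') * x * (d * d') := by rw [h, one_mul, mul_one]
    _ = d * (d' * x * d) * d' := by simp only [mul_assoc]
    _ = d * (d' * y * d) * d' := by rw [hxy]
    _ = (d * d') * y * (d * d') := by simp only [mul_assoc]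
    _ = y := by rw [h, one_mul, mul_one]

end MonomialOperators

/-! ### The enveloping algebra of `𝔰𝔩₂` and its Verma modules -/

section Enveloping

variable {K : Type*} [Field K]

/-- Homomorphisms out of `U(𝔞)` are determined by the generators. -/
theorem Ua.algHom_ext {B : Type*} [Ring B] [Algebra K B] {F G : Ua K →ₐ[K] B}
    (h : ∀ g, F (Ua.gen K g) = G (Ua.gen K g)) : F = G := by
  apply UniversalEnvelopingAlgebra.hom_ext
  let q : FreeLieAlgebra K Gen →ₗ⁅K⁆ LieA K :=
    { (Submodule.mkQ (nonDeformedIdeal K).toSubmodule : FreeLieAlgebra K Gen →ₗ[K] LieA K) with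
      map_lie' := fun {x y} => rfl }
  have hq : Function.Surjective q := Submodule.mkQ_surjective _
  let F' : LieA K →ₗ⁅K⁆ B := (F : Ua K →ₗ⁅K⁆ B).comp (UniversalEnvelopingAlgebra.ι K)
  let G' : LieA K →ₗ⁅K⁆ B := (G : Ua K →ₗ⁅K⁆ B).comp (UniversalEnvelopingAlgebra.ι K)
  have key : F'.comp q = G'.comp q := FreeLieAlgebra.hom_ext h
  apply LieHom.ext
  intro x
  obtain ⟨x, rfl⟩ := hq x
  exact LieHom.congr_fun key x

/-- The generators of `U(𝔰𝔩₂)`. -/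
def Usl2.gen (K : Type*) [Field K] (g : Gen) : Usl2 K :=
  UniversalEnvelopingAlgebra.ι K (Sl2.gen K g)

theorem Ua.toUsl2_gen (g : Gen) : Ua.toUsl2 K (Ua.gen K g) = Usl2.gen K g := by
  rw [Ua.toUsl2, Ua.gen, UniversalEnvelopingAlgebra.lift_ι_apply, LieHom.comp_apply, LieA.toSl2,
    LieA.lift_gen, Usl2.gen]

theorem Sl2.trace_eq_zero (M : Sl2 K) : M.1 0 0 + M.1 1 1 = 0 := by
  have h : Matrix.trace M.1 = 0 := M.2
  rwa [Matrix.trace_fin_two] at h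

theorem Sl2.eq_sum (M : Sl2 K) : M = M.1 0 0 • Sl2.gen K Gen.H + M.1 0 1 • Sl2.gen K Gen.Xp
    + M.1 1 0 • Sl2.gen K Gen.Xm := by
  apply Subtype.ext
  ext i j
  fin_cases i <;> fin_cases j <;> simp [Sl2.gen]
  linear_combination Sl2.trace_eq_zero M

/-- The presentation of `𝔰𝔩₂`, with values in the Lie algebra of an associative algebra. -/
def Sl2.lift {B : Type*} [Ring B] [Algebra K B] (φ : Gen → B)
    (hp : φ Gen.H * φ Gen.Xp - φ Gen.Xp * φ Gen.H = (2 : K) • φ Gen.Xp)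
    (hm : φ Gen.H * φ Gen.Xm - φ Gen.Xm * φ Gen.H = -((2 : K) • φ Gen.Xm))
    (h0 : φ Gen.Xp * φ Gen.Xm - φ Gen.Xm * φ Gen.Xp = φ Gen.H) : Sl2 K →ₗ⁅K⁆ B where
  toFun M := M.1 0 0 • φ Gen.H + M.1 0 1 • φ Gen.Xp + M.1 1 0 • φ Gen.Xm
  map_add' M N := by
    rw [show (M + N).1 = M.1 + N.1 from rfl]
    simp only [Matrix.add_apply]
    module
  map_smul' c M := by
    rw [show (c • M).1 = c • M.1 from rfl]
    simp only [Matrix.smul_apply, smul_eq_mul, RingHom.id_apply]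
    module
  map_lie' := by
    intro M N
    have hM : M.1 1 1 = -M.1 0 0 := by linear_combination Sl2.trace_eq_zero M
    have hN : N.1 1 1 = -N.1 0 0 := by linear_combination Sl2.trace_eq_zero N
    rw [LieAlgebra.SpecialLinear.sl_bracket, Ring.lie_def]
    simp only [Matrix.sub_apply, Matrix.mul_apply, Fin.sum_univ_two, hM, hN]
    have hp' := sub_eq_iff_eq_add.1 hp
    have hm' := sub_eq_iff_eq_add.1 hm
    have h0' := sub_eq_iff_eq_add.1 h0
    simp only [mul_add, add_mul, smul_mul_smul_comm, hp', hm', h0']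
    module

/-- The homomorphism `U(𝔰𝔩₂) → B` given by elements of `B` subject to the relations of `𝔰𝔩₂`. -/
def Usl2.lift {B : Type*} [Ring B] [Algebra K B] (φ : Gen → B)
    (hp : φ Gen.H * φ Gen.Xp - φ Gen.Xp * φ Gen.H = (2 : K) • φ Gen.Xp)
    (hm : φ Gen.H * φ Gen.Xm - φ Gen.Xm * φ Gen.H = -((2 : K) • φ Gen.Xm))
    (h0 : φ Gen.Xp * φ Gen.Xm - φ Gen.Xm * φ Gen.Xp = φ Gen.H) : Usl2 K →ₐ[K] B :=
  UniversalEnvelopingAlgebra.lift K (Sl2.lift φ hp hm h0)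

theorem Usl2.lift_gen {B : Type*} [Ring B] [Algebra K B] (φ : Gen → B)
    (hp : φ Gen.H * φ Gen.Xp - φ Gen.Xp * φ Gen.H = (2 : K) • φ Gen.Xp)
    (hm : φ Gen.H * φ Gen.Xm - φ Gen.Xm * φ Gen.H = -((2 : K) • φ Gen.Xm))
    (h0 : φ Gen.Xp * φ Gen.Xm - φ Gen.Xm * φ Gen.Xp = φ Gen.H) (g : Gen) :
    Usl2.lift φ hp hm h0 (Usl2.gen K g) = φ g := by
  rw [Usl2.lift, Usl2.gen, UniversalEnvelopingAlgebra.lift_ι_apply]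
  change (Sl2.gen K g).1 0 0 • φ Gen.H + (Sl2.gen K g).1 0 1 • φ Gen.Xp
    + (Sl2.gen K g).1 1 0 • φ Gen.Xm = φ g
  cases g <;> simp [Sl2.gen]

theorem Usl2.lie_H_Xp : Usl2.gen K Gen.H * Usl2.gen K Gen.Xp
    - Usl2.gen K Gen.Xp * Usl2.gen K Gen.H = (2 : K) • Usl2.gen K Gen.Xp := by
  rw [← Ring.lie_def, Usl2.gen, Usl2.gen, ← LieHom.map_lie, ← map_smul]
  congr 1
  apply Subtype.ext
  rw [LieAlgebra.SpecialLinear.sl_bracket]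
  ext i j
  fin_cases i <;> fin_cases j <;> simp [Sl2.gen, one_add_one_eq_two]

theorem Usl2.lie_H_Xm : Usl2.gen K Gen.H * Usl2.gen K Gen.Xm
    - Usl2.gen K Gen.Xm * Usl2.gen K Gen.H = -((2 : K) • Usl2.gen K Gen.Xm) := by
  rw [← Ring.lie_def, Usl2.gen, Usl2.gen, ← LieHom.map_lie, ← map_smul, ← map_neg]
  congr 1
  apply Subtype.ext
  rw [LieAlgebra.SpecialLinear.sl_bracket]
  ext i j
  fin_cases i <;> fin_cases j <;> simp [Sl2.gen, ← two_mul, sub_eq_add_neg]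

theorem Usl2.lie_Xp_Xm : Usl2.gen K Gen.Xp * Usl2.gen K Gen.Xm
    - Usl2.gen K Gen.Xm * Usl2.gen K Gen.Xp = Usl2.gen K Gen.H := by
  rw [← Ring.lie_def, Usl2.gen, Usl2.gen, ← LieHom.map_lie, Usl2.gen]
  congr 1
  apply Subtype.ext
  rw [LieAlgebra.SpecialLinear.sl_bracket]
  ext i j
  fin_cases i <;> fin_cases j <;> simp [Sl2.gen]

theorem Usl2.adjoin_gen : Algebra.adjoin K (Set.range (Usl2.gen K)) = ⊤ := by
  set S := Algebra.adjoin K (Set.range (Usl2.gen K)) with hS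
  have hg : ∀ g, Usl2.gen K g ∈ S := fun g => Algebra.subset_adjoin ⟨g, rfl⟩
  have hι : ∀ M : Sl2 K, UniversalEnvelopingAlgebra.ι K M ∈ S := fun M => by
    rw [Sl2.eq_sum M, map_add, map_add, map_smul, map_smul,
      map_smul]
    exact S.add_mem (S.add_mem (S.smul_mem (hg _) _) (S.smul_mem (hg _) _)) (S.smul_mem (hg _) _)
  let j : Sl2 K →ₗ⁅K⁆ S :=
    { toFun := fun M => ⟨UniversalEnvelopingAlgebra.ι K M, hι M⟩
      map_add' := fun M N => Subtype.ext (map_add _ M N)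
      map_smul' := fun c M => Subtype.ext (map_smul _ c M)
      map_lie' := fun {M N} => Subtype.ext (LieHom.map_lie _ M N) }
  have key : S.val.comp (UniversalEnvelopingAlgebra.lift K j) = AlgHom.id K (Usl2 K) := by
    apply UniversalEnvelopingAlgebra.hom_ext
    apply LieHom.ext
    intro M
    change S.val (UniversalEnvelopingAlgebra.lift K j (UniversalEnvelopingAlgebra.ι K M)) = _
    rw [UniversalEnvelopingAlgebra.lift_ι_apply]
    rfl
  rw [eq_top_iff]
  intro u _
  have := DFunLike.congr_fun key u
  rw [AlgHom.id_apply] at this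
  rw [← this]
  exact (UniversalEnvelopingAlgebra.lift K j u).2

/-- Induction on elements of `U(𝔰𝔩₂)` by right multiplication by generators. -/
theorem Usl2.eq_top_of_mul_right (T : Submodule K (Usl2 K)) (h1 : 1 ∈ T)
    (hT : ∀ u ∈ T, ∀ g, u * Usl2.gen K g ∈ T) : T = ⊤ := by
  let S : Subalgebra K (Usl2 K) :=
    { carrier := {y | ∀ u ∈ T, u * y ∈ T}
      mul_mem' := fun {a b} ha hb u hu => by rw [← mul_assoc]; exact hb _ (ha _ hu)
      add_mem' := fun {a b} ha hb u hu => by rw [mul_add]; exact T.add_mem (ha u hu) (hb u hu)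
      algebraMap_mem' := fun c u hu => by
        rw [← Algebra.commutes, ← Algebra.smul_def]; exact T.smul_mem c hu }
  have hS : S = ⊤ := by
    rw [eq_top_iff, ← Usl2.adjoin_gen, Algebra.adjoin_le_iff]
    rintro _ ⟨g, rfl⟩ u hu
    exact hT u hu g
  rw [eq_top_iff]
  intro u _
  have hu : u ∈ S := hS ▸ Algebra.mem_top
  simpa using hu 1 h1

/-- Induction on elements of `U(𝔰𝔩₂)` by left multiplication by generators. -/
theorem Usl2.eq_top_of_mul_left (T : Submodule K (Usl2 K)) (h1 : 1 ∈ T)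
    (hT : ∀ u ∈ T, ∀ g, Usl2.gen K g * u ∈ T) : T = ⊤ := by
  let S : Subalgebra K (Usl2 K) :=
    { carrier := {y | ∀ u ∈ T, y * u ∈ T}
      mul_mem' := fun {a b} ha hb u hu => by rw [mul_assoc]; exact ha _ (hb _ hu)
      add_mem' := fun {a b} ha hb u hu => by rw [add_mul]; exact T.add_mem (ha u hu) (hb u hu)
      algebraMap_mem' := fun c u hu => by
        rw [← Algebra.smul_def]; exact T.smul_mem c hu }
  have hS : S = ⊤ := by
    rw [eq_top_iff, ← Usl2.adjoin_gen, Algebra.adjoin_le_iff]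
    rintro _ ⟨g, rfl⟩ u hu
    exact hT u hu g
  rw [eq_top_iff]
  intro u _
  have hu : u ∈ S := hS ▸ Algebra.mem_top
  simpa using hu 1 h1

theorem Ua.toUsl2_surjective : Function.Surjective (Ua.toUsl2 K) := by
  rw [← AlgHom.range_eq_top, eq_top_iff, ← Usl2.adjoin_gen, Algebra.adjoin_le_iff]
  rintro _ ⟨g, rfl⟩
  exact ⟨Ua.gen K g, Ua.toUsl2_gen g⟩

theorem Ua.lie_H_Xp : Ua.gen K Gen.H * Ua.gen K Gen.Xp
    - Ua.gen K Gen.Xp * Ua.gen K Gen.H = (2 : K) • Ua.gen K Gen.Xp := by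
  have h : ⁅LieA.gen K Gen.H, LieA.gen K Gen.Xp⁆ = (2 : K) • LieA.gen K Gen.Xp := by
    rw [← sub_eq_zero]
    exact (Submodule.Quotient.mk_eq_zero _).2 (LieSubmodule.subset_lieSpan (Or.inl rfl))
  rw [← Ring.lie_def, Ua.gen, Ua.gen, ← LieHom.map_lie, ← map_smul, h]

theorem Ua.lie_H_Xm : Ua.gen K Gen.H * Ua.gen K Gen.Xm
    - Ua.gen K Gen.Xm * Ua.gen K Gen.H = -((2 : K) • Ua.gen K Gen.Xm) := by
  have h : ⁅LieA.gen K Gen.H, LieA.gen K Gen.Xm⁆ = -((2 : K) • LieA.gen K Gen.Xm) := by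
    rw [← sub_eq_zero, sub_neg_eq_add]
    exact (Submodule.Quotient.mk_eq_zero _).2 (LieSubmodule.subset_lieSpan (Or.inr rfl))
  rw [← Ring.lie_def, Ua.gen, Ua.gen, ← LieHom.map_lie, ← map_smul, ← map_neg, h]

/-- The action of the generators of `𝔰𝔩₂` on the Verma module `M(n)`:
`H b_i = (n - 2i) b_i`, `X⁻ b_i = b_{i+1}`, `X⁺ b_i = i (n - i + 1) b_{i-1}`. -/
def vermaGen (K : Type*) [Field K] (n : ℤ) : Gen → Module.End K (VermaSpace K)
  | Gen.H => monoEnd id fun i => (n : K) - 2 * (i : K)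
  | Gen.Xm => monoEnd Nat.succ fun _ => 1
  | Gen.Xp => monoEnd Nat.pred fun i => (i : K) * ((n : K) - (i : K) + 1)

/-- The (non-deformed) Verma module `M(n)` of `U(𝔰𝔩₂)`. -/
def classicalVerma (K : Type*) [Field K] (n : ℤ) : Usl2 K →ₐ[K] Module.End K (VermaSpace K) :=
  Usl2.lift (vermaGen K n)
    (vermaEnd_ext fun i => by
      rcases i with _ | i
      · simp [vermaGen, monoEnd_single]
      · simp only [vermaGen, LinearMap.sub_apply, Module.End.mul_apply, LinearMap.smul_apply,
          monoEnd_single, Finsupp.smul_single, ← Finsupp.single_sub, id, Nat.pred_succ]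
        congr 1
        push_cast
        simp only [smul_eq_mul]
        ring)
    (vermaEnd_ext fun i => by
      simp only [vermaGen, LinearMap.sub_apply, Module.End.mul_apply, LinearMap.smul_apply,
        LinearMap.neg_apply, ← Finsupp.single_neg,
        monoEnd_single, Finsupp.smul_single, ← Finsupp.single_sub, id, Nat.succ_eq_add_one]
      congr 1
      push_cast
      simp only [smul_eq_mul]
      ring)
    (vermaEnd_ext fun i => by
      rcases i with _ | i
      · simp [vermaGen, monoEnd_single]
      · simp only [vermaGen, LinearMap.sub_apply, Module.End.mul_apply,
          monoEnd_single, ← Finsupp.single_sub, id, Nat.pred_succ, Nat.succ_eq_add_one]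
        congr 1
        push_cast
        ring)

variable (n : ℤ) (i : ℕ) (a : K)

theorem classicalVerma_H : classicalVerma K n (Usl2.gen K Gen.H) (Finsupp.single i a)
    = Finsupp.single i (a * ((n : K) - 2 * (i : K))) := by
  rw [classicalVerma, Usl2.lift_gen, vermaGen, monoEnd_single, id]

theorem classicalVerma_Xm : classicalVerma K n (Usl2.gen K Gen.Xm) (Finsupp.single i a)
    = Finsupp.single (i + 1) a := by
  rw [classicalVerma, Usl2.lift_gen, vermaGen, monoEnd_single, mul_one]

theorem classicalVerma_Xp_zero :
    classicalVerma K n (Usl2.gen K Gen.Xp) (Finsupp.single 0 a) = 0 := by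
  rw [classicalVerma, Usl2.lift_gen, vermaGen, monoEnd_single]
  simp

theorem classicalVerma_Xp_succ :
    classicalVerma K n (Usl2.gen K Gen.Xp) (Finsupp.single (i + 1) a)
    = Finsupp.single i (a * (((i : K) + 1) * ((n : K) - (i : K)))) := by
  rw [classicalVerma, Usl2.lift_gen, vermaGen, monoEnd_single, Nat.pred_succ]
  congr 1
  push_cast
  ring

end Enveloping

/-! ### Faithfulness of the action on Verma modules -/

section Faithful

open Polynomial (aeval)

variable {K : Type*} [Field K]

local notation "hh" => Usl2.gen K Gen.H
local notation "ee" => Usl2.gen K Gen.Xp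
local notation "ff" => Usl2.gen K Gen.Xm

theorem Usl2.H_mul_Xm_pow (a : ℕ) : hh * ff ^ a = ff ^ a * (hh - algebraMap K _ (2 * (a : K))) := by
  have h1 : hh * ff = ff * (hh - algebraMap K _ 2) := by
    have := sub_eq_iff_eq_add.1 (Usl2.lie_H_Xm (K := K))
    rw [this, mul_sub, ← Algebra.commutes, ← Algebra.smul_def]
    abel
  induction a with
  | zero => simp
  | succ a ih =>
    rw [pow_succ, ← mul_assoc, ih, mul_assoc, sub_mul, h1, mul_assoc, Algebra.commutes, ← mul_sub,
      sub_sub, ← map_add]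
    congr 4
    push_cast
    ring

theorem Usl2.Xp_mul_Xm_pow_succ (a : ℕ) : ee * ff ^ (a + 1) = ff ^ (a + 1) * ee
    + ff ^ a * (algebraMap K _ ((a : K) + 1) * (hh - algebraMap K _ (a : K))) := by
  have h1 : ee * ff = ff * ee + hh := by
    rw [add_comm]; exact sub_eq_iff_eq_add.1 (Usl2.lie_Xp_Xm (K := K))
  have h2 : hh * ff = ff * (hh - algebraMap K _ 2) := by
    simpa using Usl2.H_mul_Xm_pow (K := K) 1
  induction a with
  | zero => simp [h1]
  | succ a ih =>
    have h3 : (algebraMap K (Usl2 K) ((a : K) + 1) * (hh - algebraMap K _ (a : K))) * ff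
        = ff * (algebraMap K _ ((a : K) + 1) *
          (hh - algebraMap K _ 2 - algebraMap K _ (a : K))) := by
      rw [mul_assoc, sub_mul, h2, Algebra.commutes (a : K), ← mul_sub, ← mul_assoc,
        Algebra.commutes, mul_assoc]
    rw [pow_succ ff (a + 1), ← mul_assoc, ih, add_mul, mul_assoc, h1, mul_assoc (ff ^ a), h3,
      mul_add, ← mul_assoc (ff ^ (a + 1)), ← mul_assoc (ff ^ a), ← pow_succ, ← pow_succ,
      add_assoc, ← mul_add]
    congr 2
    simp only [mul_sub, ← map_mul]
    have e1 : algebraMap K (Usl2 K) (((a + 1 : ℕ) : K) + 1) * hh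
        = hh + algebraMap K (Usl2 K) ((a : K) + 1) * hh := by
      push_cast
      simp only [add_mul, one_mul]
      abel
    rw [e1, add_sub_assoc, sub_sub, ← map_add]
    congr 4
    push_cast
    ring

theorem Usl2.Xp_mul_aeval (r : Polynomial K) :
    ee * aeval hh r = aeval hh (r.comp (Polynomial.X - Polynomial.C 2)) * ee := by
  have h1 : SemiconjBy ee hh (hh - algebraMap K _ 2) := by
    have := sub_eq_iff_eq_add.1 (Usl2.lie_H_Xp (K := K))
    rw [SemiconjBy, sub_mul, this, ← Algebra.smul_def]
    abel
  rw [Polynomial.aeval_comp]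
  simp only [map_sub, Polynomial.aeval_X, Polynomial.aeval_C]
  induction r using Polynomial.induction_on' with
  | add p q hp hq => simp only [map_add, mul_add, add_mul, hp, hq]
  | monomial m c =>
    simp only [Polynomial.aeval_monomial]
    rw [← mul_assoc, ← Algebra.commutes, mul_assoc, (h1.pow_right m).eq, mul_assoc]

/-- The linear map which sends a family `r_{a,c}` of polynomials in one variable to the ordered
expression `∑ (X⁻)ᵃ r_{a,c}(H) (X⁺)ᶜ`. -/
def pbw (K : Type*) [Field K] : (ℕ × ℕ →₀ Polynomial K) →ₗ[K] Usl2 K :=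
  Finsupp.lsum K fun p => LinearMap.mulRight K (Usl2.gen K Gen.Xp ^ p.2) ∘ₗ
    LinearMap.mulLeft K (Usl2.gen K Gen.Xm ^ p.1) ∘ₗ (aeval (Usl2.gen K Gen.H)).toLinearMap

theorem pbw_single (a c : ℕ) (r : Polynomial K) :
    pbw K (Finsupp.single (a, c) r) = ff ^ a * aeval hh r * ee ^ c := by
  simp [pbw]

/-- The easy half of the Poincaré–Birkhoff–Witt theorem for `𝔰𝔩₂`; the linear independence is
obtained from the action on Verma modules in `classicalVerma_faithful`. -/
theorem pbw_surjective : Function.Surjective (pbw K) := by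
  rw [← LinearMap.range_eq_top]
  have hmem : ∀ a c (r : Polynomial K), ff ^ a * aeval hh r * ee ^ c ∈ LinearMap.range (pbw K) :=
    fun a c r => ⟨_, pbw_single a c r⟩
  apply Usl2.eq_top_of_mul_left
  · simpa using hmem 0 0 1
  · rintro _ ⟨x, rfl⟩ g
    induction x using Finsupp.induction_linear with
    | zero => simp
    | add x y hx hy => rw [map_add, mul_add]; exact Submodule.add_mem _ hx hy
    | single p r =>
      obtain ⟨a, c⟩ := p
      rw [pbw_single]
      cases g with
      | Xm =>
        rw [← mul_assoc, ← mul_assoc, ← pow_succ']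
        exact hmem _ _ _
      | H =>
        rw [← mul_assoc, ← mul_assoc, Usl2.H_mul_Xm_pow, mul_assoc (ff ^ a)]
        have := hmem a c ((Polynomial.X - Polynomial.C (2 * (a : K))) * r)
        rwa [map_mul, map_sub, Polynomial.aeval_X, Polynomial.aeval_C] at this
      | Xp =>
        have h1 : ∀ a, ff ^ a * ee * aeval hh r * ee ^ c ∈ LinearMap.range (pbw K) := by
          intro a
          rw [mul_assoc (ff ^ a), Usl2.Xp_mul_aeval, ← mul_assoc, mul_assoc _ ee, ← pow_succ']
          exact hmem _ _ _
        rw [← mul_assoc, ← mul_assoc]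
        cases a with
        | zero => simpa using h1 0
        | succ a =>
          rw [Usl2.Xp_mul_Xm_pow_succ, add_mul, add_mul]
          refine Submodule.add_mem _ (h1 _) ?_
          have := hmem a c (Polynomial.C ((a : K) + 1) *
            (Polynomial.X - Polynomial.C (a : K)) * r)
          rwa [map_mul, map_mul, map_sub, Polynomial.aeval_X, Polynomial.aeval_C,
            Polynomial.aeval_C, ← mul_assoc] at this

theorem classicalVerma_Xm_pow (n : ℤ) (a i : ℕ) (t : K) :
    classicalVerma K n (ff ^ a) (Finsupp.single i t) = Finsupp.single (i + a) t := by
  induction a with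
  | zero => simp
  | succ a ih =>
    rw [pow_succ', map_mul, Module.End.mul_apply, ih, classicalVerma_Xm, add_assoc]

theorem classicalVerma_aeval_H (n : ℤ) (r : Polynomial K) (i : ℕ) (t : K) :
    classicalVerma K n (aeval hh r) (Finsupp.single i t)
      = Finsupp.single i (r.eval ((n : K) - 2 * (i : K)) * t) := by
  induction r using Polynomial.induction_on generalizing t with
  | C c => simp [Module.algebraMap_end_apply]
  | add p q hp hq => simp [hp, hq, add_mul]
  | monomial m c ih =>
    rw [pow_succ, ← mul_assoc, map_mul, map_mul, Polynomial.aeval_X, Module.End.mul_apply,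
      classicalVerma_H, ih]
    congr 1
    simp only [Polynomial.eval_mul, Polynomial.eval_X]
    ring

theorem classicalVerma_Xp_pow_of_lt (n : ℤ) {c i : ℕ} (h : i < c) (t : K) :
    classicalVerma K n (ee ^ c) (Finsupp.single i t) = 0 := by
  induction c generalizing i t with
  | zero => omega
  | succ c ih =>
    rw [pow_succ, map_mul, Module.End.mul_apply]
    cases i with
    | zero => rw [classicalVerma_Xp_zero, map_zero]
    | succ i => rw [classicalVerma_Xp_succ, ih (by omega)]

/-- For a negative weight `n` the Verma module `M(n)` is irreducible: no `b_i` with `i > 0` is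
killed by `X⁺`. -/
theorem classicalVerma_Xp_pow_self [CharZero K] {n : ℤ} (hn : n < 0) (c : ℕ) {t : K} (ht : t ≠ 0) :
    ∃ s : K, s ≠ 0 ∧
      classicalVerma K n (ee ^ c) (Finsupp.single c t) = Finsupp.single 0 s := by
  induction c generalizing t with
  | zero => exact ⟨t, ht, by simp⟩
  | succ c ih =>
    rw [pow_succ, map_mul, Module.End.mul_apply, classicalVerma_Xp_succ]
    apply ih
    refine mul_ne_zero ht (mul_ne_zero (by exact_mod_cast Nat.succ_ne_zero c) ?_)
    have : n - (c : ℤ) ≠ 0 := by omega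
    exact_mod_cast this

theorem infinite_neg_int [CharZero K] :
    (Set.range fun m : ℕ => ((-(m : ℤ) - 1 : ℤ) : K)).Infinite := by
  apply Set.infinite_range_of_injective
  intro a b h
  have : (-(a : ℤ) - 1 : ℤ) = -(b : ℤ) - 1 := Int.cast_injective h
  omega

/-- `U(𝔰𝔩₂)` acts faithfully on the direct sum of the Verma modules `M(n)`. -/
theorem classicalVerma_faithful [CharZero K] {u : Usl2 K}
    (hu : ∀ n, classicalVerma K n u = 0) : u = 0 := by
  obtain ⟨x, rfl⟩ := pbw_surjective u
  suffices x = 0 by rw [this, map_zero]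
  suffices ∀ c a, x (a, c) = 0 from Finsupp.ext fun p => this p.2 p.1
  intro c
  induction c using Nat.strong_induction_on with
  | _ c ih =>
    intro a
    -- the action on `b_c` only sees the terms of degree `c` in `X⁺`
    apply Polynomial.eq_zero_of_infinite_isRoot
    refine (infinite_neg_int (K := K)).mono ?_
    rintro _ ⟨m, rfl⟩
    change Polynomial.eval ((-(m : ℤ) - 1 : ℤ) : K) _ = 0
    generalize hn : -(m : ℤ) - 1 = n
    obtain ⟨s, hs, hse⟩ := classicalVerma_Xp_pow_self (K := K) (n := n) (by omega) c one_ne_zero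
    have h := DFunLike.congr_fun (DFunLike.congr_fun (hu n) (Finsupp.single c 1)) a
    rw [← x.sum_single, Finsupp.sum, map_sum, map_sum, LinearMap.sum_apply, Finsupp.finsetSum_apply,
      Finset.sum_eq_single (a, c)] at h
    · rw [pbw_single, map_mul, map_mul, Module.End.mul_apply, Module.End.mul_apply, hse,
        classicalVerma_aeval_H, classicalVerma_Xm_pow] at h
      simpa [hs] using h
    · rintro ⟨a', c'⟩ - hne
      rcases lt_trichotomy c' c with hc | rfl | hc
      · simp [ih c' hc a']
      · rw [pbw_single, map_mul, map_mul, Module.End.mul_apply, Module.End.mul_apply, hse,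
          classicalVerma_aeval_H, classicalVerma_Xm_pow]
        have : 0 + a' ≠ a := by
          rintro rfl
          simp at hne
        rw [Finsupp.single_apply, if_neg this]
      · rw [pbw_single, map_mul, Module.End.mul_apply, classicalVerma_Xp_pow_of_lt n hc]
        simp
    · intro hx
      rw [Finsupp.notMem_support_iff.1 hx]
      simp

/-- The annihilator of the highest weight vector of `M(n)` is the left ideal generated by `X⁺` and
`H - n`. -/
theorem mem_span_of_classicalVerma_eq_zero {n : ℤ} {u : Usl2 K}
    (hu : classicalVerma K n u (Finsupp.single 0 1) = 0) :
    u ∈ Ideal.span {ee, hh - algebraMap K _ (n : K)} := by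
  set J := Ideal.span {ee, hh - algebraMap K (Usl2 K) (n : K)} with hJ
  have he : ee ∈ J := Ideal.subset_span (Or.inl rfl)
  have hh' : hh - algebraMap K (Usl2 K) (n : K) ∈ J := Ideal.subset_span (Or.inr rfl)
  -- modulo the left ideal, every element is a combination of the `(X⁻)ᵃ`, and these are sent to
  -- linearly independent vectors
  have key : ∀ x, pbw K x - (x.sum fun p r =>
      if p.2 = 0 then r.eval (n : K) • ff ^ p.1 else 0) ∈ J := by
    intro x
    induction x using Finsupp.induction_linear with
    | zero => simp
    | add x y hx hy =>
      rw [map_add, Finsupp.sum_add_index' (by simp)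
        (by intro p r s; split_ifs <;> simp [add_smul]), add_sub_add_comm]
      exact J.add_mem hx hy
    | single p r =>
      obtain ⟨a, c⟩ := p
      rw [pbw_single, Finsupp.sum_single_index (by simp)]
      cases c with
      | zero =>
        rw [if_pos rfl, pow_zero, mul_one, Algebra.smul_def, Algebra.commutes, ← mul_sub]
        refine J.mul_mem_left _ ?_
        obtain ⟨q, hq⟩ := Polynomial.X_sub_C_dvd_sub_C_eval (a := (n : K)) (p := r)
        have := congrArg (aeval hh) hq
        rw [map_sub, Polynomial.aeval_C, mul_comm, map_mul, map_sub, Polynomial.aeval_X,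
          Polynomial.aeval_C] at this
        rw [this]
        exact J.mul_mem_left _ hh'
      | succ c =>
        rw [if_neg (Nat.succ_ne_zero c), sub_zero, pow_succ, ← mul_assoc]
        exact J.mul_mem_left _ he
  have hJ0 : ∀ y ∈ J, classicalVerma K n y (Finsupp.single 0 1) = 0 := by
    intro y hy
    obtain ⟨b, c, rfl⟩ := Ideal.mem_span_pair.1 hy
    have h1 : classicalVerma K n (hh - algebraMap K (Usl2 K) (n : K)) (Finsupp.single 0 1) = 0 := by
      rw [map_sub, LinearMap.sub_apply, classicalVerma_H, AlgHom.commutes,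
        Module.algebraMap_end_apply]
      simp
    rw [map_add, map_mul, map_mul, LinearMap.add_apply, Module.End.mul_apply,
      Module.End.mul_apply, classicalVerma_Xp_zero, h1, map_zero, map_zero, add_zero]
  obtain ⟨x, rfl⟩ := pbw_surjective u
  have h0 := hJ0 _ (key x)
  rw [map_sub, LinearMap.sub_apply, hu, zero_sub, neg_eq_zero] at h0
  suffices hs : (x.sum fun p r => if p.2 = 0 then r.eval (n : K) • ff ^ p.1 else 0) = 0 by
    have := key x
    rwa [hs, sub_zero] at this
  rw [Finsupp.sum]
  apply Finset.sum_eq_zero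
  rintro ⟨a, c⟩ hp
  by_cases hc : c = 0
  · subst hc
    have ha := DFunLike.congr_fun h0 a
    rw [Finsupp.sum, map_sum, LinearMap.sum_apply, Finsupp.finsetSum_apply,
      Finset.sum_eq_single (a, 0)] at ha
    · rw [if_pos rfl, map_smul, LinearMap.smul_apply, classicalVerma_Xm_pow] at ha
      simp only [zero_add, Finsupp.smul_single, Finsupp.single_eq_same, smul_eq_mul, mul_one,
        Finsupp.coe_zero, Pi.zero_apply] at ha
      rw [if_pos rfl, ha, zero_smul]
    · rintro ⟨a', c'⟩ - hne
      by_cases hc' : c' = 0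
      · subst hc'
        rw [if_pos rfl, map_smul, LinearMap.smul_apply, classicalVerma_Xm_pow]
        have : a' ≠ a := by
          rintro rfl
          exact hne rfl
        simp [this]
      · simp [hc']
    · exact fun h => absurd hp h
  · rw [if_neg hc]

end Faithful

/-! ### Matrix coefficients of the action on Verma modules -/

section MatrixCoefficients

variable {K : Type*} [Field K]

theorem exists_eval_substitution (P a b : MvPolynomial (Fin 2) K) : ∃ Q : MvPolynomial (Fin 2) K,
    ∀ x, MvPolynomial.eval x Q
      = MvPolynomial.eval ![MvPolynomial.eval x a, MvPolynomial.eval x b] P := by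
  refine ⟨MvPolynomial.bind₁ ![a, b] P, fun x => ?_⟩
  induction P using MvPolynomial.induction_on with
  | C c => simp
  | add p q hp hq => simp only [map_add, hp, hq]
  | mul_X p i hp =>
    simp only [map_mul, hp, MvPolynomial.bind₁_X_right, MvPolynomial.eval_X]
    fin_cases i <;> rfl

/-- The matrix coefficients of an element of `U(𝔰𝔩₂)` along a fixed diagonal depend polynomially on
the index of the basis vector and on the highest weight. -/
theorem classicalVerma_coeff_polynomial (u : Usl2 K) (j : ℤ) : ∃ P : MvPolynomial (Fin 2) K,
    ∀ (n : ℤ) (i l : ℕ), (l : ℤ) = i + j →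
      classicalVerma K n u (Finsupp.single i 1) l = MvPolynomial.eval ![(i : K), (n : K)] P := by
  let T : Submodule K (Usl2 K) :=
    { carrier := {u | ∀ j : ℤ, ∃ P : MvPolynomial (Fin 2) K, ∀ (n : ℤ) (i l : ℕ), (l : ℤ) = i + j →
        classicalVerma K n u (Finsupp.single i 1) l = MvPolynomial.eval ![(i : K), (n : K)] P}
      zero_mem' := fun j => ⟨0, fun n i l _ => by simp⟩
      add_mem' := fun {a b} ha hb j => by
        obtain ⟨P, hP⟩ := ha j
        obtain ⟨Q, hQ⟩ := hb j
        exact ⟨P + Q, fun n i l h => by simp [hP n i l h, hQ n i l h]⟩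
      smul_mem' := fun c a ha j => by
        obtain ⟨P, hP⟩ := ha j
        exact ⟨MvPolynomial.C c * P, fun n i l h => by simp [hP n i l h]⟩ }
  suffices hT : T = ⊤ by
    have : u ∈ T := hT ▸ Submodule.mem_top
    exact this j
  apply Usl2.eq_top_of_mul_right
  · intro j
    by_cases hj : j = 0
    · refine ⟨1, fun n i l h => ?_⟩
      have : l = i := by omega
      simp [this]
    · refine ⟨0, fun n i l h => ?_⟩
      have : i ≠ l := by omega
      simp [this]
  -- Right multiplication by a generator acts first on `b_i`, so no index leaves the range `l ≥ 0`.
  · intro u hu g j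
    simp only [map_mul, Module.End.mul_apply]
    cases g with
    | H =>
      obtain ⟨P, hP⟩ := hu j
      refine ⟨(MvPolynomial.X 1 - 2 * MvPolynomial.X 0) * P, fun n i l h => ?_⟩
      rw [classicalVerma_H, one_mul, ← mul_one ((n : K) - _), ← smul_eq_mul, ← Finsupp.smul_single,
        map_smul, Finsupp.smul_apply, hP n i l h]
      simp
    | Xm =>
      obtain ⟨P, hP⟩ := hu (j - 1)
      obtain ⟨Q, hQ⟩ := exists_eval_substitution P (MvPolynomial.X 0 + 1) (MvPolynomial.X 1)
      refine ⟨Q, fun n i l h => ?_⟩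
      rw [classicalVerma_Xm, hP n (i + 1) l (by push_cast; omega), hQ]
      simp
    | Xp =>
      obtain ⟨P, hP⟩ := hu (j + 1)
      obtain ⟨Q, hQ⟩ := exists_eval_substitution P (MvPolynomial.X 0 - 1) (MvPolynomial.X 1)
      refine ⟨MvPolynomial.X 0 * (MvPolynomial.X 1 - MvPolynomial.X 0 + 1) * Q, fun n i l h => ?_⟩
      cases i with
      | zero => simp [classicalVerma_Xp_zero]
      | succ i =>
        rw [classicalVerma_Xp_succ, one_mul, ← mul_one (((i : K) + 1) * _), ← smul_eq_mul (_ * _),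
          ← Finsupp.smul_single, map_smul, Finsupp.smul_apply,
          hP n i l (by push_cast at h; omega), map_mul, hQ]
        simp only [map_mul, map_add, map_sub, map_one, MvPolynomial.eval_X, Matrix.cons_val_zero,
          Matrix.cons_val_one, Nat.cast_succ, add_sub_cancel_right, smul_eq_mul]
        ring

/-- For `n ≥ 0`, the map `b_i ↦ b_{n+1+i}` is a homomorphism `M(-n-2) → M(n)`. -/
theorem classicalVerma_shift (n : ℕ) (u : Usl2 K) :
    classicalVerma K n u * monoEnd (fun i => i + (n + 1)) (fun _ => 1)
      = monoEnd (fun i => i + (n + 1)) (fun _ => 1) * classicalVerma K (-(n : ℤ) - 2) u := by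
  let T : Submodule K (Usl2 K) :=
    { carrier := {u | classicalVerma K n u * monoEnd (fun i => i + (n + 1)) (fun _ => 1)
        = monoEnd (fun i => i + (n + 1)) (fun _ => 1) * classicalVerma K (-(n : ℤ) - 2) u}
      zero_mem' := by simp
      add_mem' := fun {a b} ha hb => by
        simp only [Set.mem_ofPred_eq, map_add, add_mul, mul_add] at ha hb ⊢
        rw [ha, hb]
      smul_mem' := fun c a ha => by
        simp only [Set.mem_ofPred_eq, map_smul, smul_mul_assoc, mul_smul_comm] at ha ⊢
        rw [ha] }
  suffices hT : T = ⊤ by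
    have : u ∈ T := hT ▸ Submodule.mem_top
    exact this
  apply Usl2.eq_top_of_mul_left
  · change _ = _
    simp
  · intro u hu g
    change _ = _ at hu
    change _ = _
    rw [map_mul, map_mul, mul_assoc, hu, ← mul_assoc, ← mul_assoc]
    congr 1
    refine vermaEnd_ext fun i => ?_
    simp only [Module.End.mul_apply, monoEnd_single, mul_one]
    cases g with
    | H =>
      simp only [classicalVerma_H, monoEnd_single]
      congr 1
      push_cast
      ring
    | Xm =>
      simp only [classicalVerma_Xm, monoEnd_single, mul_one]
      congr 1
      omega
    | Xp =>
      cases i with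
      | zero =>
        rw [zero_add, classicalVerma_Xp_zero, classicalVerma_Xp_succ]
        simp
      | succ i =>
        rw [show i + 1 + (n + 1) = i + (n + 1) + 1 by ring, classicalVerma_Xp_succ,
          classicalVerma_Xp_succ, monoEnd_single]
        congr 1
        push_cast
        ring

theorem monoEnd_shift_apply (N : ℕ) (v : VermaSpace K) (l : ℕ) :
    monoEnd (fun i => i + N) (fun _ => 1) v l = if l < N then 0 else v (l - N) := by
  induction v using Finsupp.induction_linear with
  | zero => simp
  | add v w hv hw => rw [map_add, Finsupp.add_apply, hv, hw]; split_ifs <;> simp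
  | single i a =>
    rw [monoEnd_single, Finsupp.single_apply, Finsupp.single_apply, mul_one]
    split_ifs <;> first | rfl | omega

theorem classicalVerma_coeff_shift (n : ℕ) (u : Usl2 K) (i l : ℕ) :
    classicalVerma K n u (Finsupp.single (i + (n + 1)) 1) l = if l < n + 1 then 0 else
      classicalVerma K (-(n : ℤ) - 2) u (Finsupp.single i 1) (l - (n + 1)) := by
  have h := DFunLike.congr_fun (DFunLike.congr_fun (classicalVerma_shift n u)
    (Finsupp.single i 1)) l
  rwa [Module.End.mul_apply, Module.End.mul_apply, monoEnd_single, mul_one,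
    monoEnd_shift_apply] at h

theorem classicalVerma_H_apply (n : ℤ) (v : VermaSpace K) (l : ℕ) :
    classicalVerma K n (Usl2.gen K Gen.H) v l = ((n : K) - 2 * (l : K)) * v l := by
  induction v using Finsupp.induction_linear with
  | zero => simp
  | add v w hv hw => rw [map_add, Finsupp.add_apply, hv, hw, Finsupp.add_apply, mul_add]
  | single i a =>
    rw [classicalVerma_H, Finsupp.single_apply, Finsupp.single_apply]
    split_ifs with h
    · rw [h, mul_comm]
    · rw [mul_zero]

/-- An element of weight `2d` for the adjoint action of `H` maps `b_i` to a multiple of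
`b_{i-d}`. -/
theorem classicalVerma_coeff_eq_zero [CharZero K] {x : Usl2 K} {d : ℤ}
    (hx : Usl2.gen K Gen.H * x - x * Usl2.gen K Gen.H = (2 * d : K) • x) (n : ℤ) (i l : ℕ)
    (h : (l : ℤ) ≠ i - d) : classicalVerma K n x (Finsupp.single i 1) l = 0 := by
  have h1 := DFunLike.congr_fun (DFunLike.congr_fun (congrArg (classicalVerma K n) hx)
    (Finsupp.single i 1)) l
  rw [map_sub, map_mul, map_mul, map_smul, LinearMap.sub_apply, Module.End.mul_apply,
    Module.End.mul_apply, classicalVerma_H, one_mul, ← mul_one ((n : K) - _), ← smul_eq_mul,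
    ← Finsupp.smul_single, map_smul, LinearMap.smul_apply, Finsupp.sub_apply, Finsupp.smul_apply,
    Finsupp.smul_apply, classicalVerma_H_apply, smul_eq_mul, smul_eq_mul] at h1
  have h2 : ((l : K) - (i - d)) ≠ 0 := by
    rw [sub_ne_zero]
    exact_mod_cast h
  have h3 : (-2 * ((l : K) - (i - d))) * classicalVerma K n x (Finsupp.single i 1) l = 0 := by
    linear_combination h1
  exact (mul_eq_zero.1 h3).resolve_left (mul_ne_zero (by norm_num) h2)

theorem classicalVerma_weight_two [CharZero K] {x : Usl2 K}
    (hx : Usl2.gen K Gen.H * x - x * Usl2.gen K Gen.H = (2 : K) • x) (n : ℤ) :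
    classicalVerma K n x = monoEnd Nat.pred fun i =>
      if i = 0 then 0 else classicalVerma K n x (Finsupp.single i 1) (i - 1) := by
  refine vermaEnd_ext fun i => Finsupp.ext fun l => ?_
  have h0 := classicalVerma_coeff_eq_zero (d := 1) (x := x) (by simpa using hx) n i l
  rw [monoEnd_single, one_mul, Finsupp.single_apply]
  rcases i with _ | i
  · simpa using h0 (by omega)
  · simp only [Nat.pred_succ, Nat.succ_ne_zero, if_false, Nat.add_sub_cancel]
    split_ifs with h
    · rw [h]
    · exact h0 (by push_cast; omega)

theorem classicalVerma_weight_neg_two [CharZero K] {x : Usl2 K}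
    (hx : Usl2.gen K Gen.H * x - x * Usl2.gen K Gen.H = -((2 : K) • x)) (n : ℤ) :
    classicalVerma K n x = monoEnd Nat.succ fun i =>
      classicalVerma K n x (Finsupp.single i 1) (i + 1) := by
  refine vermaEnd_ext fun i => Finsupp.ext fun l => ?_
  have h0 := classicalVerma_coeff_eq_zero (d := -1) (x := x) (by simpa using hx) n i l
  rw [monoEnd_single, one_mul, Finsupp.single_apply]
  split_ifs with h
  · rw [← h]
  · exact h0 (by omega)

end MatrixCoefficients

/-! ### Realisation of polynomial symmetric functions -/

section Realisation

open Polynomial Bivariate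

variable {K : Type*} [Field K]

/-- The functions `φ(n, i)` for which some element of `U(𝔰𝔩₂)` acts on every Verma module `M(n)`
by `b_i ↦ φ(n, i) b_i`. -/
def IsDiagonal (φ : ℤ → ℕ → K) : Prop :=
  ∃ s : Usl2 K, ∀ n i t,
    classicalVerma K n s (Finsupp.single i t) = Finsupp.single i (t * φ n i)

theorem IsDiagonal.const (c : K) : IsDiagonal fun _ _ => c :=
  ⟨algebraMap K _ c, fun n i t => by simp [Module.algebraMap_end_apply, mul_comm]⟩

theorem IsDiagonal.add {φ χ : ℤ → ℕ → K} (hφ : IsDiagonal φ) (hχ : IsDiagonal χ) :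
    IsDiagonal fun n i => φ n i + χ n i := by
  obtain ⟨s, hs⟩ := hφ
  obtain ⟨t, ht⟩ := hχ
  exact ⟨s + t, fun n i a => by
    rw [map_add, LinearMap.add_apply, hs, ht, ← Finsupp.single_add, mul_add]⟩

theorem IsDiagonal.mul {φ χ : ℤ → ℕ → K} (hφ : IsDiagonal φ) (hχ : IsDiagonal χ) :
    IsDiagonal fun n i => φ n i * χ n i := by
  obtain ⟨s, hs⟩ := hφ
  obtain ⟨t, ht⟩ := hχ
  exact ⟨s * t, fun n i a => by
    rw [map_mul, Module.End.mul_apply, ht, hs]; congr 1; ring⟩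

theorem IsDiagonal.pow {φ : ℤ → ℕ → K} (hφ : IsDiagonal φ) (m : ℕ) :
    IsDiagonal fun n i => φ n i ^ m := by
  induction m with
  | zero => simpa using IsDiagonal.const (1 : K)
  | succ m ih => simpa only [pow_succ] using ih.mul hφ

theorem IsDiagonal.H : IsDiagonal fun n i => (n : K) - 2 * (i : K) :=
  ⟨_, classicalVerma_H⟩

/-- The Casimir element `4 X⁻X⁺ + (H + 1)²` acts on `M(n)` by `(n + 1)²`. -/
theorem IsDiagonal.casimir : IsDiagonal fun n _ => ((n : K) + 1) ^ 2 := by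
  have h1 : IsDiagonal fun n i => (i : K) * ((n : K) - i + 1) :=
    ⟨Usl2.gen K Gen.Xm * Usl2.gen K Gen.Xp, fun n i t => by
      rw [map_mul, Module.End.mul_apply]
      rcases i with _ | i
      · simp [classicalVerma_Xp_zero]
      · rw [classicalVerma_Xp_succ, classicalVerma_Xm]
        congr 1
        push_cast
        ring⟩
  have h2 := ((IsDiagonal.const (4 : K)).mul h1).add
    ((IsDiagonal.H.add (IsDiagonal.const 1)).pow 2)
  convert h2 using 3
  ring

theorem IsDiagonal.evalEval {φ χ : ℤ → ℕ → K} (hφ : IsDiagonal φ) (hχ : IsDiagonal χ)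
    (Q : K[X][Y]) : IsDiagonal fun n i => Q.evalEval (φ n i) (χ n i) := by
  induction Q using Polynomial.induction_on' with
  | add p q hp hq => simpa using hp.add hq
  | monomial m r =>
    have hr : IsDiagonal fun n i => r.eval (φ n i) := by
      induction r using Polynomial.induction_on' with
      | add p q hp hq => simpa using hp.add hq
      | monomial l c => simpa using (IsDiagonal.const c).mul (hφ.pow l)
    simpa [← Polynomial.C_mul_X_pow_eq_monomial, Polynomial.evalEval_mul,
      Polynomial.evalEval_C] using
      hr.mul (hχ.pow m)

theorem bivariate_eq_zero {B : K[X][Y]} {S : Set K} (hS : S.Infinite)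
    (h : ∀ y ∈ S, {x | B.evalEval x y = 0}.Infinite) : B = 0 := by
  apply Polynomial.eq_zero_of_infinite_isRoot
  refine (hS.image (Polynomial.C_injective.injOn)).mono ?_
  rintro _ ⟨y, hy, rfl⟩
  exact Polynomial.eq_zero_of_infinite_isRoot _ (h y hy)

theorem eval_eval_eq_evalEval (A : K[X][Y]) (r : K[X]) (x : K) :
    (A.eval r).eval x = A.evalEval x (r.eval x) := by
  rw [← Polynomial.map_evalRingHom_eval, Polynomial.eval_map]
  exact (Polynomial.eval₂_at_apply (Polynomial.evalRingHom x) r).symm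

variable [CharZero K]

/-- In the coordinates `μ = n - 2k` and `ν = n + 1` the involution `(k, n) ↦ (k - n - 1, -n - 2)` is
`ν ↦ -ν`, and every polynomial decomposes into an even and an odd part in `ν`. -/
theorem exists_even_odd (P : MvPolynomial (Fin 2) K) : ∃ A B : K[X][Y], ∀ k n : K,
    MvPolynomial.eval ![k, n] P = A.evalEval (n - 2 * k) ((n + 1) ^ 2)
      + (n + 1) * B.evalEval (n - 2 * k) ((n + 1) ^ 2) := by
  induction P using MvPolynomial.induction_on with
  | C c => exact ⟨C (C c), 0, fun k n => by simp⟩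
  | add p q hp hq =>
    obtain ⟨A, B, h⟩ := hp
    obtain ⟨A', B', h'⟩ := hq
    exact ⟨A + A', B + B', fun k n => by
      rw [map_add, h, h', evalEval_add, evalEval_add]; ring⟩
  | mul_X p i hp =>
    obtain ⟨A, B, h⟩ := hp
    have h2 : (2 : K) ≠ 0 := two_ne_zero
    fin_cases i
    · refine ⟨C (C (1 / 2)) * (B * Y - (C (X + 1)) * A),
        C (C (1 / 2)) * (A - C (X + 1) * B), fun k n => ?_⟩
      rw [map_mul, h]
      simp [evalEval_mul, evalEval_sub, evalEval_C]
      field_simp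
      ring
    · refine ⟨B * Y - A, A - B, fun k n => ?_⟩
      rw [map_mul, h]
      simp [evalEval_mul, evalEval_sub]
      ring

/-- A polynomial which satisfies the symmetries of a colouring is divisible by `k (n - k + 1)`, with
a quotient which is a polynomial in the eigenvalues of `H` and of the Casimir element. -/
theorem exists_quotient (P : MvPolynomial (Fin 2) K)
    (h0 : ∀ n : ℕ, MvPolynomial.eval ![(n : K) + 1, (n : K)] P = 0)
    (h1 : ∀ k n : ℕ, 1 ≤ k → MvPolynomial.eval ![(n : K) + k + 1, (n : K)] P
      = MvPolynomial.eval ![(k : K), -(n : K) - 2] P) :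
    ∃ Q : K[X][Y], ∀ k n : K, MvPolynomial.eval ![k, n] P
      = k * (n - k + 1) * Q.evalEval (n - 2 * k) ((n + 1) ^ 2) := by
  obtain ⟨A, B, h⟩ := exists_even_odd P
  -- the symmetry forces the odd part to vanish
  have hB : B = 0 := by
    refine bivariate_eq_zero (S := Set.range fun n : ℕ => ((n : K) + 1) ^ 2) ?_ ?_
    · apply Set.infinite_range_of_injective
      intro a b hab
      have hab : ((a : K) + 1) ^ 2 = ((b : K) + 1) ^ 2 := hab
      have : (a + 1) ^ 2 = (b + 1) ^ 2 := by exact_mod_cast hab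
      have := Nat.pow_left_injective (n := 2) (by norm_num) this
      omega
    · rintro _ ⟨n, rfl⟩
      refine (Set.infinite_range_of_injective (f := fun k : ℕ => -(n : K) - 2 - 2 * (k + 1))
        ?_).mono ?_
      · intro a b hab
        simpa using hab
      · rintro _ ⟨k, rfl⟩
        have e := h1 (k + 1) n (by omega)
        rw [h, h] at e
        push_cast at e
        rw [show (n : K) - 2 * ((n : K) + ((k : K) + 1) + 1) = -(n : K) - 2 - 2 * ((k : K) + 1) by
          ring, show (-(n : K) - 2 + 1) ^ 2 = ((n : K) + 1) ^ 2 by ring] at e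
        have e2 : (2 * ((n : K) + 1)) *
            B.evalEval (-(n : K) - 2 - 2 * ((k : K) + 1)) (((n : K) + 1) ^ 2) = 0 := by
          linear_combination e
        refine (mul_eq_zero.1 e2).resolve_left (mul_ne_zero two_ne_zero ?_)
        exact_mod_cast Nat.succ_ne_zero n
  simp only [hB, evalEval_zero, mul_zero, add_zero] at h
  -- the zeros at `k = n + 1` are the points `μ = -n - 2`, `ν² = (μ + 1)²`
  have hA : A.IsRoot ((X + 1) ^ 2) := by
    apply Polynomial.eq_zero_of_infinite_isRoot
    refine (Set.infinite_range_of_injective (f := fun n : ℕ => -(n : K) - 2) ?_).mono ?_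
    · intro a b hab
      simpa using hab
    · rintro _ ⟨n, rfl⟩
      have e := h0 n
      rw [h] at e
      change Polynomial.eval _ (Polynomial.eval _ A) = 0
      rw [eval_eval_eq_evalEval]
      convert e using 2
      · ring
      · simp; ring
  obtain ⟨Q, hQ⟩ := Polynomial.dvd_iff_isRoot.2 hA
  -- `ν² - (μ + 1)² = 4 k (n - k + 1)`
  refine ⟨C (C 4) * Q, fun k n => ?_⟩
  rw [h, hQ, evalEval_mul, evalEval_mul, evalEval_sub]
  simp only [evalEval_C, eval_C, evalEval_X, eval_pow, eval_add, eval_X, eval_one]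
  ring

/-- Every polynomial with the symmetries of a colouring is realised by an element of `U(𝔰𝔩₂)`. -/
theorem exists_realisation (P : MvPolynomial (Fin 2) K)
    (h0 : ∀ n : ℕ, MvPolynomial.eval ![(n : K) + 1, (n : K)] P = 0)
    (h1 : ∀ k n : ℕ, 1 ≤ k → MvPolynomial.eval ![(n : K) + k + 1, (n : K)] P
      = MvPolynomial.eval ![(k : K), -(n : K) - 2] P) :
    ∃ x : Usl2 K, ∀ (n : ℤ) (c : ℕ → K), c 0 = 0 →
      (∀ i : ℕ, c (i + 1) = MvPolynomial.eval ![(i : K) + 1, (n : K)] P) →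
      classicalVerma K n x = monoEnd Nat.pred c := by
  obtain ⟨Q, hQ⟩ := exists_quotient P h0 h1
  obtain ⟨s, hs⟩ := IsDiagonal.evalEval IsDiagonal.H IsDiagonal.casimir Q
  refine ⟨Usl2.gen K Gen.Xp * s, fun n c hc0 hc => vermaEnd_ext fun i => ?_⟩
  rw [map_mul, Module.End.mul_apply, hs, one_mul, monoEnd_single, one_mul]
  rcases i with _ | i
  · rw [classicalVerma_Xp_zero, hc0, Finsupp.single_zero]
  · rw [classicalVerma_Xp_succ, Nat.pred_succ, hc, hQ]
    congr 1
    push_cast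
    ring

end Realisation

/-! ### `𝔥`-trivial deformations and colourings -/

section Deformations

variable {K : Type*} [Field K]

theorem UaAction_eq (ψ : Colouring K) (n : ℤ) {ρ : Ua K →ₐ[K] (Module.End K (VermaSpace K))⟦X⟧}
    (h : ∀ g, ψ.genAction n g = ρ (Ua.gen K g)) : ψ.UaAction n = ρ :=
  Ua.algHom_ext (B := (Module.End K (VermaSpace K))⟦X⟧) fun g => by
    rw [Colouring.UaAction_gen, h]

theorem mapSeries_classicalVerma_H (n : ℤ) :
    mapSeries (classicalVerma K n) (PowerSeries.C (Usl2.gen K Gen.H))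
      = mono id fun i => PowerSeries.C ((n : K) - 2 * (i : K)) := by
  rw [mapSeries_C, classicalVerma, Usl2.lift_gen, vermaGen, C_monoEnd]

/-- If `X⁺` and `X⁻` act on `M(n)⟦h⟧` through `F` by `b_i ↦ cᵢ b_{i-1}` and `b_i ↦ dᵢ b_{i+1}`,
with `dᵢ` invertible, then a diagonal change of basis turns this action into the one on `V(n, ψ)`,
for `ψⁱ⁺¹(n) = cᵢ₊₁ dᵢ`. -/
theorem exists_conj (F : Uha K →ₐ[K⟦X⟧] (Usl2 K)⟦X⟧) (ψ : Colouring K) (n : ℤ) (c d : ℕ → K⟦X⟧)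
    (hH : F (PowerSeries.C (Ua.gen K Gen.H)) = PowerSeries.C (Usl2.gen K Gen.H))
    (hp : mapSeries (classicalVerma K n) (F (PowerSeries.C (Ua.gen K Gen.Xp))) = mono Nat.pred c)
    (hm : mapSeries (classicalVerma K n) (F (PowerSeries.C (Ua.gen K Gen.Xm))) = mono Nat.succ d)
    (hc : c 0 = 0) (hd : ∀ i, PowerSeries.constantCoeff (d i) = 1)
    (hψ : ∀ i, ψ.coef n (i + 1) = c (i + 1) * d i) :
    ∃ T : (Module.End K (VermaSpace K))⟦X⟧ →ₐ[K⟦X⟧] (Module.End K (VermaSpace K))⟦X⟧,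
      Function.Injective T ∧
      extendSeries (ψ.UaAction n) = (T.comp (mapSeries (classicalVerma K n))).comp F := by
  -- the new basis vectors `(X⁻)ⁱ b_0 = δᵢ b_i`
  let δ : ℕ → K⟦X⟧ := fun i => ∏ j ∈ Finset.range i, d j
  have hδ : ∀ i, PowerSeries.constantCoeff (δ i) ≠ 0 := fun i => by
    simp [δ, map_prod, hd]
  have hδi : ∀ i, (δ i)⁻¹ * δ i = 1 := fun i => PowerSeries.inv_mul_cancel _ (hδ i)
  have hδs : ∀ i, δ (i + 1) = δ i * d i := fun i => Finset.prod_range_succ _ _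
  have h1 : mono id δ * mono id (fun i => (δ i)⁻¹) = 1 := by
    rw [mono_mul, ← mono_id_one]
    congr 1
    funext i
    rw [mul_comm]
    exact hδi i
  have h2 : mono id (fun i => (δ i)⁻¹) * mono id δ = 1 := by
    rw [mono_mul, ← mono_id_one]
    congr 1
    funext i
    exact hδi i
  refine ⟨conjHom _ _ h1 h2, conjHom_injective _ _ h1 h2, ?_⟩
  rw [← extendSeries_restrictC (((conjHom _ _ h1 h2).comp (mapSeries (classicalVerma K n))).comp F)]
  congr 1
  refine UaAction_eq _ _ fun g => ?_
  rw [restrictC_apply, AlgHom.comp_apply, AlgHom.comp_apply, conjHom_apply]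
  cases g with
  | H =>
    rw [hH, mapSeries_classicalVerma_H, Colouring.genAction_H, mono_mul, mono_mul]
    congr 1
    funext i
    simp only [id]
    rw [mul_right_comm, hδi, one_mul]
  | Xm =>
    rw [hm, Colouring.genAction_Xm, mono_mul, mono_mul]
    congr 1
    funext i
    simp only [id]
    rw [mul_assoc, mul_comm (d i), ← hδs, hδi]
  | Xp =>
    rw [hp, Colouring.genAction_Xp, mono_mul, mono_mul]
    congr 1
    funext i
    rcases i with _ | i
    · simp [hc, Colouring.coef]
    · simp only [id, Nat.pred_succ]
      rw [hψ, hδs, ← mul_assoc, mul_right_comm _ (c _), hδi, one_mul]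

/-- Since `U(𝔰𝔩₂)` acts faithfully on the Verma modules, the kernel of `F` consists of the elements
which act by zero on all `M(n)⟦h⟧`. -/
theorem ker_eq_ideal [CharZero K] (F : Uha K →ₐ[K⟦X⟧] (Usl2 K)⟦X⟧) (ψ : Colouring K)
    (h : ∀ n, ∃ T : (Module.End K (VermaSpace K))⟦X⟧ →ₐ[K⟦X⟧] (Module.End K (VermaSpace K))⟦X⟧,
      Function.Injective T ∧
      extendSeries (ψ.UaAction n) = (T.comp (mapSeries (classicalVerma K n))).comp F) :
    RingHom.ker F = ψ.ideal := by
  ext x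
  rw [Colouring.mem_ideal_iff, RingHom.mem_ker]
  have key : ∀ n, extendSeries (ψ.UaAction n) x = 0 ↔ mapSeries (classicalVerma K n) (F x) = 0 := by
    intro n
    obtain ⟨T, hT, e⟩ := h n
    rw [e, AlgHom.comp_apply, AlgHom.comp_apply, map_eq_zero_iff _ hT]
  simp only [key]
  constructor
  · intro hx n
    rw [hx, map_zero]
  · intro hx
    ext m
    rw [map_zero]
    apply classicalVerma_faithful
    intro n
    rw [← mapSeries_coeff, hx, map_zero]

/-- A surjective homomorphism out of `U_h(𝔞)` with kernel `I_h(ψ)` is the projection to `U_h(ψ)`, up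
to isomorphism. -/
theorem exists_equiv_Uh {B : Type*} [Ring B] [Algebra K⟦X⟧ B] (F : Uha K →ₐ[K⟦X⟧] B)
    (ψ : Colouring K) (hF : Function.Surjective F) (hk : RingHom.ker F = ψ.ideal) :
    ∃ e : B ≃ₐ[K⟦X⟧] ψ.Uh, ∀ x, e (F x) = ψ.proj x := by
  refine ⟨(Ideal.quotientKerAlgEquivOfSurjective hF).symm.trans
    (Ideal.quotientEquivAlgOfEq K⟦X⟧ hk), fun x => ?_⟩
  rw [AlgEquiv.trans_apply, Ideal.quotientKerAlgEquivOfSurjective_symm_apply]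
  rfl

/-- A `𝔥`-trivialized deformation `F : U_h(𝔞) → U(𝔰𝔩₂)⟦h⟧` is the projection to `U_h(ψ)`, where
`ψᵏ(n)` is the eigenvalue of `X⁺X⁻` on the `(k-1)`-st basis vector of `M(n)⟦h⟧`. -/
theorem exists_colouring [CharZero K] (F : Uha K →ₐ[K⟦X⟧] (Usl2 K)⟦X⟧)
    (hH : F (PowerSeries.C (Ua.gen K Gen.H)) = PowerSeries.C (Usl2.gen K Gen.H))
    (h0 : ∀ u, PowerSeries.constantCoeff (F (PowerSeries.C u)) = Ua.toUsl2 K u) :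
    ∃ ψ : Colouring K, ψ.IsRegular ∧ RingHom.ker F = ψ.ideal := by
  let x : ℕ → Usl2 K := fun m => PowerSeries.coeff m (F (PowerSeries.C (Ua.gen K Gen.Xp)))
  let y : ℕ → Usl2 K := fun m => PowerSeries.coeff m (F (PowerSeries.C (Ua.gen K Gen.Xm)))
  have hx0 : x 0 = Usl2.gen K Gen.Xp := by
    rw [← Ua.toUsl2_gen, ← h0]
    exact PowerSeries.coeff_zero_eq_constantCoeff_apply _
  have hy0 : y 0 = Usl2.gen K Gen.Xm := by
    rw [← Ua.toUsl2_gen, ← h0]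
    exact PowerSeries.coeff_zero_eq_constantCoeff_apply _
  have hx : ∀ m, Usl2.gen K Gen.H * x m - x m * Usl2.gen K Gen.H = (2 : K) • x m := by
    intro m
    have h := congrArg (restrictC F) (Ua.lie_H_Xp (K := K))
    rw [map_sub, map_mul, map_mul, map_smul, restrictC_apply, restrictC_apply, hH] at h
    have := congrArg (PowerSeries.coeff m) h
    rwa [map_sub, PowerSeries.coeff_C_mul, PowerSeries.coeff_mul_C, PowerSeries.coeff_smul] at this
  have hy : ∀ m, Usl2.gen K Gen.H * y m - y m * Usl2.gen K Gen.H = -((2 : K) • y m) := by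
    intro m
    have h := congrArg (restrictC F) (Ua.lie_H_Xm (K := K))
    rw [map_sub, map_mul, map_mul, map_neg, map_smul, restrictC_apply, restrictC_apply, hH] at h
    have := congrArg (PowerSeries.coeff m) h
    rwa [map_sub, PowerSeries.coeff_C_mul, PowerSeries.coeff_mul_C, map_neg,
      PowerSeries.coeff_smul] at this
  let c : ℤ → ℕ → K⟦X⟧ := fun n i => PowerSeries.mk fun m =>
    if i = 0 then 0 else classicalVerma K n (x m) (Finsupp.single i 1) (i - 1)
  let d : ℤ → ℕ → K⟦X⟧ := fun n i => PowerSeries.mk fun m =>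
    classicalVerma K n (y m) (Finsupp.single i 1) (i + 1)
  have hc : ∀ n, mapSeries (classicalVerma K n) (F (PowerSeries.C (Ua.gen K Gen.Xp)))
      = mono Nat.pred (c n) := by
    intro n
    ext1 m
    rw [mapSeries_coeff, coeff_mono]
    simp only [c, PowerSeries.coeff_mk]
    exact classicalVerma_weight_two (hx m) n
  have hd : ∀ n, mapSeries (classicalVerma K n) (F (PowerSeries.C (Ua.gen K Gen.Xm)))
      = mono Nat.succ (d n) := by
    intro n
    ext1 m
    rw [mapSeries_coeff, coeff_mono]
    simp only [d, PowerSeries.coeff_mk]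
    exact classicalVerma_weight_neg_two (hy m) n
  have hd0 : ∀ n i, PowerSeries.constantCoeff (d n i) = 1 := by
    intro n i
    rw [← PowerSeries.coeff_zero_eq_constantCoeff_apply, PowerSeries.coeff_mk, hy0,
      classicalVerma_Xm, Finsupp.single_eq_same]
  -- the symmetries come from the homomorphism `M(-n-2) → M(n)`
  have hcs : ∀ (n i : ℕ), 1 ≤ i → c n (i + (n + 1)) = c (-(n : ℤ) - 2) i := by
    intro n i hi
    ext m
    simp only [c, PowerSeries.coeff_mk]
    rw [if_neg (by omega), if_neg (by omega), classicalVerma_coeff_shift, if_neg (by omega)]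
    congr 1
    omega
  have hcz : ∀ n : ℕ, c n (n + 1) = 0 := by
    intro n
    ext m
    simp only [c, PowerSeries.coeff_mk]
    have := classicalVerma_coeff_shift n (x m) 0 n
    rw [zero_add, if_pos (by omega)] at this
    rw [if_neg (by omega), Nat.add_sub_cancel, this, map_zero]
  have hds : ∀ (n i : ℕ), d n (i + (n + 1)) = d (-(n : ℤ) - 2) i := by
    intro n i
    ext m
    simp only [d, PowerSeries.coeff_mk]
    rw [classicalVerma_coeff_shift, if_neg (by omega)]
    congr 1
    omega
  let ψ : Colouring K :=
    { toFun := fun k n => c n k * d n (k - 1)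
      constantCoeff_eq := fun k n => by
        obtain ⟨i, hi⟩ : ∃ i : ℕ, (k : ℕ) = i + 1 := ⟨k - 1, by have := k.pos; omega⟩
        rw [map_mul, hd0, mul_one, ← PowerSeries.coeff_zero_eq_constantCoeff_apply,
          PowerSeries.coeff_mk, hx0, hi, if_neg (by omega), classicalVerma_Xp_succ,
          Nat.add_sub_cancel, Finsupp.single_eq_same]
        push_cast
        ring
      eq_zero := fun n => by
        rw [Nat.succPNat_coe, Nat.succ_eq_add_one, hcz, zero_mul]
      eq_shift := fun k n => by
        obtain ⟨i, hi⟩ : ∃ i : ℕ, (k : ℕ) = i + 1 := ⟨k - 1, by have := k.pos; omega⟩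
        rw [Nat.succPNat_coe, Nat.succ_eq_add_one, hi, Nat.add_sub_cancel, Nat.add_sub_cancel,
          ← hcs n (i + 1) (by omega), ← hds]
        congr 2 <;> omega }
  refine ⟨ψ, ?_, ker_eq_ideal F ψ fun n =>
    exists_conj F ψ n (c n) (d n) hH (hc n) (hd n) ?_ (hd0 n) fun i => rfl⟩
  · intro m
    choose P hP using fun m => classicalVerma_coeff_polynomial (x m) (-1)
    choose Q hQ using fun m => classicalVerma_coeff_polynomial (y m) 1
    choose R hR using fun m => exists_eval_substitution (Q m)
      (MvPolynomial.X 0 - 1) (MvPolynomial.X 1)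
    refine ⟨∑ p ∈ antidiagonal m, P p.1 * R p.2, fun k n => ?_⟩
    obtain ⟨i, hi⟩ : ∃ i : ℕ, (k : ℕ) = i + 1 := ⟨k - 1, by have := k.pos; omega⟩
    change PowerSeries.coeff m (c n k * d n (k - 1)) = _
    rw [PowerSeries.coeff_mul, map_sum]
    refine Finset.sum_congr rfl fun p _ => ?_
    rw [map_mul, hR, PowerSeries.coeff_mk, PowerSeries.coeff_mk, hi, if_neg (by omega),
      hP _ n (i + 1) _ (by push_cast; omega), hQ _ n _ _ (by push_cast; omega)]
    simp
  · ext m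
    simp [c]

/-- A regular colouring is realised by the homomorphism `U_h(𝔞) → U(𝔰𝔩₂)⟦h⟧` which fixes `H` and
`X⁻`, and maps `X⁺` to the series of weight `2` acting on the Verma modules by `ψ`. -/
theorem exists_hom_of_isRegular [CharZero K] (ψ : Colouring K) (hψ : ψ.IsRegular) :
    ∃ F : Uha K →ₐ[K⟦X⟧] (Usl2 K)⟦X⟧,
      F (PowerSeries.C (Ua.gen K Gen.H)) = PowerSeries.C (Usl2.gen K Gen.H) ∧
      (∀ u, PowerSeries.constantCoeff (F (PowerSeries.C u)) = Ua.toUsl2 K u) ∧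
      ∀ n, extendSeries (ψ.UaAction n) = (mapSeries (classicalVerma K n)).comp F := by
  have hex : ∀ m, ∃ x : Usl2 K, ∀ n : ℤ, classicalVerma K n x
      = monoEnd Nat.pred fun i => PowerSeries.coeff m (ψ.coef n i) := by
    intro m
    obtain ⟨P, hP⟩ := hψ m
    obtain ⟨x, hx⟩ := exists_realisation P
      (fun n => by
        have := hP (Nat.succPNat n) n
        rw [ψ.eq_zero, map_zero] at this
        simpa using this.symm)
      (fun k n hk => by
        have h1 := hP (Nat.succPNat (n + k)) n
        have h2 := hP ⟨k, hk⟩ (-(n : ℤ) - 2)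
        have h3 := ψ.eq_shift ⟨k, hk⟩ n
        simp only [PNat.mk_coe] at h3
        rw [h3, h2] at h1
        simpa using h1.symm)
    refine ⟨x, fun n => hx n _ (by simp [Colouring.coef]) fun i => ?_⟩
    have := hP (Nat.succPNat i) n
    simpa [Colouring.coef] using this
  choose x hx using hex
  have hx0 : x 0 = Usl2.gen K Gen.Xp := by
    rw [← sub_eq_zero]
    apply classicalVerma_faithful
    intro n
    rw [map_sub, sub_eq_zero, hx, classicalVerma, Usl2.lift_gen, vermaGen]
    congr 1
    funext i
    rcases i with _ | i
    · simp [Colouring.coef]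
    · rw [Colouring.coef, PowerSeries.coeff_zero_eq_constantCoeff_apply, ψ.constantCoeff_eq]
      simp
  have hw : ∀ m, Usl2.gen K Gen.H * x m - x m * Usl2.gen K Gen.H = (2 : K) • x m := by
    intro m
    rw [← sub_eq_zero]
    apply classicalVerma_faithful
    intro n
    rw [map_sub, sub_eq_zero, map_sub, map_mul, map_mul, map_smul]
    refine vermaEnd_ext fun i => ?_
    rw [LinearMap.sub_apply, Module.End.mul_apply, Module.End.mul_apply, LinearMap.smul_apply,
      classicalVerma_H, hx, monoEnd_single, monoEnd_single, classicalVerma_H,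
      ← Finsupp.single_sub, Finsupp.smul_single]
    congr 1
    rcases i with _ | i
    · simp [Colouring.coef]
    · rw [Nat.pred_succ, smul_eq_mul]
      push_cast
      ring
  let φg : Gen → (Usl2 K)⟦X⟧ := fun g => match g with
    | Gen.H => PowerSeries.C (Usl2.gen K Gen.H)
    | Gen.Xm => PowerSeries.C (Usl2.gen K Gen.Xm)
    | Gen.Xp => PowerSeries.mk x
  let φ : Ua K →ₐ[K] (Usl2 K)⟦X⟧ := UniversalEnvelopingAlgebra.lift K (LieA.lift φg
    (by
      rw [Ring.lie_def]
      ext1 m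
      rw [map_sub, PowerSeries.coeff_C_mul, PowerSeries.coeff_mul_C, PowerSeries.coeff_smul,
        PowerSeries.coeff_mk, hw])
    (by
      rw [Ring.lie_def]
      simp only [φg]
      rw [← map_mul, ← map_mul, ← map_sub, Usl2.lie_H_Xm, map_neg]
      congr 1
      ext1 m
      rw [PowerSeries.coeff_smul, PowerSeries.coeff_C, PowerSeries.coeff_C]
      split_ifs <;> simp))
  have hφ : ∀ g, φ (Ua.gen K g) = φg g := fun g => by
    simp only [φ]
    rw [Ua.gen, UniversalEnvelopingAlgebra.lift_ι_apply, LieA.lift_gen]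
  refine ⟨extendSeries φ, by rw [extendSeries_C, hφ], ?_, ?_⟩
  · let κ : (Usl2 K)⟦X⟧ →ₐ[K] Usl2 K :=
      { (PowerSeries.constantCoeff : (Usl2 K)⟦X⟧ →+* Usl2 K) with
        commutes' := fun c => by
          change PowerSeries.constantCoeff (algebraMap K (Usl2 K)⟦X⟧ c) = _
          rw [PowerSeries.algebraMap_apply, PowerSeries.constantCoeff_C] }
    have : κ.comp φ = Ua.toUsl2 K := by
      apply Ua.algHom_ext
      intro g
      rw [AlgHom.comp_apply, hφ, Ua.toUsl2_gen]
      change PowerSeries.constantCoeff (φg g) = _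
      cases g with
      | H => exact PowerSeries.constantCoeff_C _
      | Xm => exact PowerSeries.constantCoeff_C _
      | Xp => rw [← hx0]; exact PowerSeries.constantCoeff_mk
    intro u
    rw [extendSeries_C]
    exact DFunLike.congr_fun this u
  · intro n
    rw [← extendSeries_restrictC ((mapSeries (classicalVerma K n)).comp (extendSeries φ))]
    congr 1
    refine UaAction_eq _ _ fun g => ?_
    rw [restrictC_apply, AlgHom.comp_apply, extendSeries_C, hφ]
    cases g with
    | H => rw [mapSeries_classicalVerma_H, Colouring.genAction_H]
    | Xm =>
      rw [mapSeries_C, classicalVerma, Usl2.lift_gen, vermaGen, C_monoEnd, Colouring.genAction_Xm,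
        map_one]
    | Xp =>
      rw [Colouring.genAction_Xp]
      ext1 m
      rw [mapSeries_coeff, coeff_mono, PowerSeries.coeff_mk, hx]

theorem mono_succ_pow (i : ℕ) :
    mono (K := K) Nat.succ (fun _ => 1) ^ i = mono (fun j => j + i) fun _ => 1 := by
  induction i with
  | zero => rw [pow_zero, ← mono_id_one]; rfl
  | succ i ih =>
    rw [pow_succ, ih, mono_mul]
    congr 1
    · funext j; simp only [Function.comp]; omega
    · funext j; rw [one_mul]

theorem algebraMap_eq_mono (r : K⟦X⟧) :
    algebraMap K⟦X⟧ (Module.End K (VermaSpace K))⟦X⟧ r = mono id fun _ => r := by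
  ext1 m
  rw [seriesAlgebra_algebraMap, PowerSeries.coeff_map, coeff_mono]
  refine vermaEnd_ext fun i => ?_
  simp [monoEnd_single, Module.algebraMap_end_apply]

/-- The element `X⁺ (X⁻)ⁱ⁺¹ - r (X⁻)ⁱ` of `U_h(𝔞)`. It kills the highest weight vector of `V(n, ψ)`
if and only if `r = ψⁱ⁺¹(n)`. -/
def highestWeightRelation (i : ℕ) (r : K⟦X⟧) : Uha K :=
  PowerSeries.C (Ua.gen K Gen.Xp) * PowerSeries.C (Ua.gen K Gen.Xm) ^ (i + 1)
    - algebraMap K⟦X⟧ (Uha K) r * PowerSeries.C (Ua.gen K Gen.Xm) ^ i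

theorem coeff_highestWeightRelation (ψ : Colouring K) (n : ℤ) (i : ℕ) (r : K⟦X⟧) (m : ℕ) :
    PowerSeries.coeff m (extendSeries (ψ.UaAction n) (highestWeightRelation i r))
      (Finsupp.single 0 1)
      = Finsupp.single i (PowerSeries.coeff m (ψ.toFun (Nat.succPNat i) n - r)) := by
  rw [highestWeightRelation, map_sub, map_mul, map_mul, map_pow, map_pow,
    AlgHom.commutes, extendSeries_C,
    extendSeries_C, Colouring.UaAction_gen, Colouring.UaAction_gen, Colouring.genAction_Xp,
    Colouring.genAction_Xm, mono_succ_pow, mono_succ_pow, algebraMap_eq_mono, mono_mul, mono_mul,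
    map_sub, coeff_mono, coeff_mono, LinearMap.sub_apply, monoEnd_single, monoEnd_single]
  simp [Colouring.coef, ← Finsupp.single_sub]

/-- If `I_h(ψ) = I_h(ψ')`, then `U_h(ψ) = U(𝔰𝔩₂)⟦h⟧` acts on `V(n, ψ')` with highest weight vector
`b_0` of weight `n`, so everything which kills the highest weight vector of `V(n, ψ)` kills that of
`V(n, ψ')`; apply this to `highestWeightRelation`. -/
theorem colouring_eq_of_ideal_eq [CharZero K] {ψ ψ' : Colouring K} (hψ : ψ.IsRegular)
    (h : ψ.ideal = ψ'.ideal) : ψ = ψ' := by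
  obtain ⟨F, hH, h0, hF⟩ := exists_hom_of_isRegular ψ hψ
  have hker : RingHom.ker F = ψ.ideal :=
    ker_eq_ideal F ψ fun n => ⟨AlgHom.id _ _, Function.injective_id, hF n⟩
  have hsurj := surjective_of_constantCoeff F _ Ua.toUsl2_surjective h0
  have key : ∀ n i, ψ.toFun (Nat.succPNat i) n = ψ'.toFun (Nat.succPNat i) n := by
    intro n i
    -- the action of `U(𝔰𝔩₂)⟦h⟧` on `V(n, ψ')`
    obtain ⟨τ, hτ⟩ := exists_factor F hsurj (extendSeries (ψ'.UaAction n)) fun x hx =>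
      (Colouring.mem_ideal_iff ψ' x).1 (h ▸ hker ▸ hx) n
    have hτH : τ (PowerSeries.C (Usl2.gen K Gen.H))
        = PowerSeries.C (classicalVerma K n (Usl2.gen K Gen.H)) := by
      rw [← hH, hτ, extendSeries_C, Colouring.UaAction_gen, Colouring.genAction_H,
        ← mapSeries_classicalVerma_H, mapSeries_C]
    let b : FormalSeries (VermaSpace K) := constSeries (Finsupp.single 0 1)
    let T : (Usl2 K)⟦X⟧ →ₗ[K⟦X⟧] FormalSeries (VermaSpace K) :=
      LinearMap.applyₗ b ∘ₗ (seriesEnd K (VermaSpace K)).toLinearMap ∘ₗ τ.toLinearMap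
    have hT : ∀ z m, T z m = PowerSeries.coeff m (τ z) (Finsupp.single 0 1) := fun z m =>
      seriesEnd_constSeries _ _ _
    have hTmul : ∀ y z, T z = 0 → T (y * z) = 0 := by
      intro y z hz
      change seriesEnd K _ (τ z) b = 0 at hz
      change seriesEnd K _ (τ (y * z)) b = 0
      rw [map_mul, map_mul, Module.End.mul_apply, hz, map_zero]
    -- `X⁺` kills `b_0` since `n + 2` is not a weight of `V(n, ψ')`
    have hTe : T (PowerSeries.C (Usl2.gen K Gen.Xp)) = 0 := by
      funext m
      rw [hT]
      set E := PowerSeries.coeff m (τ (PowerSeries.C (Usl2.gen K Gen.Xp))) with hE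
      have h1 := congrArg (restrictC τ) (Usl2.lie_H_Xp (K := K))
      rw [map_sub, map_mul, map_mul, map_smul, restrictC_apply, restrictC_apply, hτH] at h1
      have h2 := congrArg (PowerSeries.coeff m) h1
      rw [map_sub, PowerSeries.coeff_C_mul, PowerSeries.coeff_mul_C, PowerSeries.coeff_smul,
        ← hE] at h2
      ext l
      have h3 := DFunLike.congr_fun (DFunLike.congr_fun h2 (Finsupp.single 0 1)) l
      rw [LinearMap.sub_apply, Module.End.mul_apply, Module.End.mul_apply, LinearMap.smul_apply,
        Finsupp.sub_apply, classicalVerma_H_apply, classicalVerma_H, one_mul,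
        ← mul_one ((n : K) - 2 * ((0 : ℕ) : K)), ← smul_eq_mul _ (1 : K), ← Finsupp.smul_single,
        map_smul, Finsupp.smul_apply, Finsupp.smul_apply, smul_eq_mul, smul_eq_mul] at h3
      have h4 : (-2 * ((l : K) + 1)) * E (Finsupp.single 0 1) l = 0 := by
        push_cast at h3
        linear_combination h3
      have h5 : (l : K) + 1 ≠ 0 := by exact_mod_cast Nat.succ_ne_zero l
      exact (mul_eq_zero.1 h4).resolve_left (mul_ne_zero (by norm_num) h5)
    have hTh : T (PowerSeries.C (Usl2.gen K Gen.H - algebraMap K _ (n : K))) = 0 := by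
      funext m
      have e : algebraMap K (Usl2 K)⟦X⟧ (n : K) = PowerSeries.C (algebraMap K (Usl2 K) (n : K)) :=
        PowerSeries.algebraMap_apply
      have e' : τ (PowerSeries.C (algebraMap K (Usl2 K) (n : K)))
          = PowerSeries.C (algebraMap K _ (n : K)) := by
        rw [← e]
        have := (restrictC τ).commutes (n : K)
        rw [restrictC_apply, ← e] at this
        rw [this, PowerSeries.algebraMap_apply]
      rw [hT, map_sub, map_sub, hτH, e', ← map_sub, PowerSeries.coeff_C]
      split_ifs
      · rw [LinearMap.sub_apply, classicalVerma_H, Module.algebraMap_end_apply]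
        simp
        rfl
      · rfl
    have hTz : T (F (highestWeightRelation i (ψ.toFun (Nat.succPNat i) n))) = 0 := by
      apply linearMap_eq_zero
      intro m
      have hmem : PowerSeries.coeff m (F (highestWeightRelation i (ψ.toFun (Nat.succPNat i) n))) ∈
          Ideal.span {Usl2.gen K Gen.Xp, Usl2.gen K Gen.H - algebraMap K _ (n : K)} := by
        apply mem_span_of_classicalVerma_eq_zero
        rw [← mapSeries_coeff, ← AlgHom.comp_apply, ← hF, coeff_highestWeightRelation,
          sub_self, map_zero,
          Finsupp.single_zero]
      obtain ⟨p, q, hpq⟩ := Ideal.mem_span_pair.1 hmem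
      rw [← hpq, map_add, map_mul, map_mul, map_add, hTmul _ _ hTe, hTmul _ _ hTh, add_zero]
    rw [eq_comm, ← sub_eq_zero]
    ext m
    have h1 := congrFun hTz m
    rw [hT, hτ, coeff_highestWeightRelation] at h1
    have h2 := DFunLike.congr_fun h1 i
    rw [Finsupp.single_eq_same] at h2
    exact h2
  ext1
  funext k n
  have := key n k.natPred
  rwa [PNat.succPNat_natPred] at this

theorem isHTrivialDeformation_proj [CharZero K] (ψ : Colouring K) (hψ : ψ.IsRegular) :
    IsHTrivialDeformation ψ.proj := by
  obtain ⟨F, hH, h0, hF⟩ := exists_hom_of_isRegular ψ hψ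
  have hker : RingHom.ker F = ψ.ideal :=
    ker_eq_ideal F ψ fun n => ⟨AlgHom.id _ _, Function.injective_id, hF n⟩
  have hsurj := surjective_of_constantCoeff F _ Ua.toUsl2_surjective h0
  obtain ⟨g, hg⟩ := exists_equiv_Uh F ψ hsurj hker
  refine ⟨⟨isTopologicallyFree_of_equiv g, (modHEquiv g).symm.trans (modHSeries K (Usl2 K)),
    fun u => ?_⟩, g, ?_, (modHEquiv g).bijective, fun u => ?_⟩
  · rw [AlgEquiv.trans_apply, ← h0, ← modHSeries_mk (k := K)]
    congr 1
    refine (AlgEquiv.symm_apply_eq _).2 ?_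
    change Ideal.Quotient.mk _ (ψ.proj (PowerSeries.C u))
      = Ideal.Quotient.mk _ (g (F (PowerSeries.C u)))
    rw [hg]
  · rw [Ua.toUsl2_gen, ← hH, hg]
  · rw [← modHEquiv_apply]
    have : modHStructure ψ.proj u
        = modHEquiv g (Ideal.Quotient.mk (hIdeal K _) (F (PowerSeries.C u))) := by
      change Ideal.Quotient.mk _ (ψ.proj (PowerSeries.C u))
        = Ideal.Quotient.mk _ (g (F (PowerSeries.C u)))
      rw [hg]
    rw [this]
    congr 1
    apply (modHSeries K (Usl2 K)).injective
    rw [modHSeries_mk, h0]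
    change PowerSeries.constantCoeff (mapSeries (Ua.toUsl2 K) (PowerSeries.C u)) = _
    rw [mapSeries_C, PowerSeries.constantCoeff_C]

theorem exists_isRegular_equiv [CharZero K] {A : Type*} [Ring A] [Algebra K⟦X⟧ A]
    (f : Uha K →ₐ[K⟦X⟧] A) (g : (Usl2 K)⟦X⟧ ≃ₐ[K⟦X⟧] A) (hg : IsHTrivialization f g) :
    ∃ ψ : Colouring K, ψ.IsRegular ∧ ∃ e : A ≃ₐ[K⟦X⟧] ψ.Uh, ∀ x : Uha K, e (f x) = ψ.proj x := by
  let F : Uha K →ₐ[K⟦X⟧] (Usl2 K)⟦X⟧ := (g.symm : A →ₐ[K⟦X⟧] (Usl2 K)⟦X⟧).comp f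
  have hFf : ∀ x, F x = g.symm (f x) := fun x => rfl
  have hH : F (PowerSeries.C (Ua.gen K Gen.H)) = PowerSeries.C (Usl2.gen K Gen.H) := by
    rw [hFf, AlgEquiv.symm_apply_eq, ← hg.map_H, Ua.toUsl2_gen]
  have h0 : ∀ u, PowerSeries.constantCoeff (F (PowerSeries.C u)) = Ua.toUsl2 K u := by
    intro u
    have h1 : modHEquiv g (Ideal.Quotient.mk (hIdeal K _) (PowerSeries.C (Ua.toUsl2 K u)))
        = modHEquiv g (Ideal.Quotient.mk (hIdeal K _) (F (PowerSeries.C u))) := by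
      have h2 := hg.modH_structure u
      change Ideal.Quotient.mk _ (g (mapSeries (Ua.toUsl2 K) (PowerSeries.C u)))
        = Ideal.Quotient.mk _ (f (PowerSeries.C u)) at h2
      rw [mapSeries_C] at h2
      change Ideal.Quotient.mk _ (g (PowerSeries.C (Ua.toUsl2 K u)))
        = Ideal.Quotient.mk _ (g (F (PowerSeries.C u)))
      rw [h2, hFf, AlgEquiv.apply_symm_apply]
    have h3 := congrArg (modHSeries K (Usl2 K)) ((modHEquiv g).injective h1)
    rw [modHSeries_mk, modHSeries_mk, PowerSeries.constantCoeff_C] at h3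
    exact h3.symm
  obtain ⟨ψ, hψ, hker⟩ := exists_colouring F hH h0
  obtain ⟨e, he⟩ := exists_equiv_Uh F ψ
    (surjective_of_constantCoeff F _ Ua.toUsl2_surjective h0) hker
  exact ⟨ψ, hψ, g.symm.trans e, fun x => he x⟩

end Deformations

end ColouredKM

end

open ColouredKM
theorem mainTheorem2 {K : Type*} [Field K] [CharZero K] :
    (∀ (A : Type*) [Ring A] [Algebra K⟦X⟧ A] (f : Uha K →ₐ[K⟦X⟧] A),
      IsHTrivialDeformation f →
        ∃! ψ : Colouring K, ψ.IsRegular ∧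
          ∃ e : A ≃ₐ[K⟦X⟧] ψ.Uh, ∀ x : Uha K, e (f x) = ψ.proj x) ∧
    (∀ ψ : Colouring K, ψ.IsRegular → IsHTrivialDeformation ψ.proj) := by
  refine ⟨fun A _ _ f hf => ?_, isHTrivialDeformation_proj⟩
  obtain ⟨g, hg⟩ := hf.trivial
  obtain ⟨ψ, hψ, e, he⟩ := exists_isRegular_equiv f g hg
  refine ⟨ψ, ⟨hψ, e, he⟩, ?_⟩
  rintro ψ' ⟨-, e', he'⟩
  refine (colouring_eq_of_ideal_eq hψ ?_).symm
  ext x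
  rw [← Ideal.Quotient.eq_zero_iff_mem, ← Ideal.Quotient.eq_zero_iff_mem]
  change ψ.proj x = 0 ↔ ψ'.proj x = 0
  rw [← he, ← he', map_eq_zero_iff _ e.injective, map_eq_zero_iff _ e'.injective]
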